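/- For $d\in\mathbb{N}$, $\alpha\in\mathbb{R}$, $1\le p,q\le\infty$ let $B^{\alpha}_{p,q}=B^{\alpha}_{p,q}(\mathbb{R}^d)$ be the inhomogeneous Besov space of tempered distributions $u$ with $\|u\|_{B^\alpha_{p,q}}=\big\|\big(2^{j\alpha}\|\varphi_j(D)u\|_{L^p}\big)_{j\ge0}\big\|_{\ell^q}<\infty$, where $(\varphi_j)_{j\ge 0}$ is a fixed smooth dyadic partition of unity on frequency space. For a normed space $E$ and $r\ge1$, $V^r(E)=V^r(a,b;E)$ is the set of $u:[a,b]\to E$ (not necessarily continuous) with $$\|u\|_{V^r(E)}:=\sup_{a=t_0<t_1<\dots<t_n=b}\Big(\sum_{h=1}^n\|u(t_h)-u(t_{h-1})\|_E^r\Big)^{1/r}<\infty,$$ and $V^r=V^r(\mathbb{R}^d)$. For a measurable path $\omega:[a,b]\to\mathbb{R}^d$ its occupation measure is $\mu_{s,t}=\int_s^t\delta_{\omega_\tau}\,d\tau$, $a\le s\le t\le b$. **Proposition 3.3.** Let $\alpha\in\mathbb{R}$, $r>1$, $1<p<\infty$, $1\le q\le\infty$, $r_1\ge1$, let $r'$ be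 the Hölder conjugate of $r$, and let $\frac{r_1}{r'}<\gamma\le1$. Let $\omega:[a,b]\to\mathbb{R}^d$ be a measurable path whose occupation measure $\mu$ satisfies $\mu_{a,\cdot}\in V^r(B^{\alpha}_{p,q})$. For $f:[a,b]\to\mathbb{R}^d$ let $\mu^f$ be the occupation measure of $\omega^f:=\omega+f$. 1. If $f\in V^{r_1}$, then $\mu^f_{a,\cdot}\in V^r(B^{\alpha-\gamma}_{p,q})$. 2. There is a constant $C$, depending only on $d,\alpha,p,q,r,r_1,\gamma$ (and not on $a,b,\omega,f,g$), such that for all $f,g\in V^{r_1}$ $$\|\mu^f_{a,\cdot}-\mu^g_{a,\cdot}\|_{V^r(B^{\alpha-\gamma-1}_{p,q})}\le C\,\|\mu_{a,\cdot}\|_{V^r(B^{\alpha}_{p,q})}\Big(\|f-g\|_{V^{r_1}}+\big(1+\|g\|_{V^{r_1}}\big)\|f-g\|_{L^\infty}\Big),$$ where $L^\infty=L^\infty([a,b],dt)$. -/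

import Mathlib

open MeasureTheory Set
open scoped ENNReal NNReal SchwartzMap

noncomputable section

namespace OccBesov

/-- The space `ℝ^d` with its Euclidean norm. -/
abbrev Rd (d : ℕ) : Type := EuclideanSpace ℝ (Fin d)

/-- A smooth cut-off on frequency space: equal to `1` on `|ξ| ≤ 1`, supported in `|ξ| ≤ 2`,
with values in `[0, 1]`. -/
def cutoff (d : ℕ) (ξ : Rd d) : ℝ :=
  (⟨1, 2, one_pos, one_lt_two⟩ : ContDiffBump (0 : Rd d)) ξ

/-- The inhomogeneous dyadic partition of unity on frequency space: `φ₀ = χ` and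
`φ_{j+1}(ξ) = χ(2^{-(j+1)} ξ) - χ(2^{-j} ξ)`, where `χ` is the cut-off above. -/
def dyadic (d : ℕ) : ℕ → Rd d → ℝ
  | 0, ξ => cutoff d ξ
  | j + 1, ξ => cutoff d (((2 : ℝ) ^ (j + 1))⁻¹ • ξ) - cutoff d (((2 : ℝ) ^ j)⁻¹ • ξ)

/-- The dyadic functions are smooth and compactly supported, hence Fourier multipliers. -/
theorem dyadic_hasTemperateGrowth (d j : ℕ) :
    (fun ξ : Rd d => (dyadic d j ξ : ℂ)).HasTemperateGrowth := by
  have hc : HasCompactSupport (cutoff d) := ContDiffBump.hasCompactSupport _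
  have hs : ContDiff ℝ (⊤ : ℕ∞) (cutoff d) := ContDiffBump.contDiff _
  have hcs : HasCompactSupport (dyadic d j) := by
    cases j with
    | zero => exact hc
    | succ j =>
      have := fun k : ℕ => hc.comp_smul (c := ((2 : ℝ) ^ k)⁻¹) (by positivity)
      exact (this (j + 1)).sub (this j)
  have hsm : ContDiff ℝ (⊤ : ℕ∞) (dyadic d j) := by
    cases j with
    | zero => exact hs
    | succ j => exact (hs.comp (contDiff_const_smul _)).sub (hs.comp (contDiff_const_smul _))
  have h1 : HasCompactSupport (fun ξ : Rd d => (dyadic d j ξ : ℂ)) :=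
    hcs.comp_left (g := fun x : ℝ => (x : ℂ)) (by simp)
  exact (h1.toSchwartzMap (Complex.ofRealCLM.contDiff.comp hsm)).hasTemperateGrowth

/-- The Littlewood--Paley block `u ↦ 𝓕⁻¹ (φ_j 𝓕 u)` on tempered distributions. -/
def block (d j : ℕ) : 𝓢'(Rd d, ℂ) →L[ℂ] 𝓢'(Rd d, ℂ) :=
  TemperedDistribution.fourierMultiplierCLM ℂ (fun ξ : Rd d => (dyadic d j ξ : ℂ))

/-- The `L^p` norm of a tempered distribution: the norm of the (unique) `L^p` function which
represents it, and `∞` if there is none. -/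
def distLpNorm {d : ℕ} (p : ℝ≥0∞) [Fact (1 ≤ p)] (u : 𝓢'(Rd d, ℂ)) : ℝ≥0∞ :=
  ⨅ (h : Lp ℂ p (volume : Measure (Rd d))) (_ : Lp.toTemperedDistribution h = u), ‖h‖ₑ

/-- The `ℓ^q` norm of a sequence in `[0, ∞]`. -/
def seqNorm (q : ℝ≥0∞) (c : ℕ → ℝ≥0∞) : ℝ≥0∞ :=
  if q = ∞ then ⨆ j, c j else (∑' j, c j ^ q.toReal) ^ (1 / q.toReal)

/-- The norm of the inhomogeneous Besov space `B^α_{p,q}(ℝ^d)`, with values in `[0, ∞]`: the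
`ℓ^q` norm of `2^{jα} ‖φ_j(D) u‖_{L^p}`. The space consists of the tempered distributions for
which it is finite. -/
def besovNorm {d : ℕ} (α : ℝ) (p q : ℝ≥0∞) [Fact (1 ≤ p)] (u : 𝓢'(Rd d, ℂ)) : ℝ≥0∞ :=
  seqNorm q fun j => (2 : ℝ≥0∞) ^ ((j : ℝ) * α) * distLpNorm p (block d j u)

/-- The `r`-variation seminorm on `[a, b]` of a path, with increments measured by `N`:
the supremum over all finite increasing sequences `t₀ ≤ t₁ ≤ ⋯ ≤ t_n` in `[a, b]` of
`(∑ N (u t_{i+1} - u t_i) ^ r) ^ (1 / r)`. (As in `eVariationOn`, the sequences may repeat points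
and need not contain `a` and `b`; this does not change the supremum when `N 0 = 0`.) -/
def rVariation {F : Type*} [Sub F] (N : F → ℝ≥0∞) (r a b : ℝ) (u : ℝ → F) : ℝ≥0∞ :=
  (⨆ P : ℕ × {t : ℕ → ℝ // Monotone t ∧ ∀ i, t i ∈ Icc a b},
    ∑ i ∈ Finset.range P.1, N (u (P.2.1 (i + 1)) - u (P.2.1 i)) ^ r) ^ (1 / r)

/-- Membership in `V^r(a, b; E)`, where `E` is the space on which `N` is finite: the path takes
values in `E` on `[a, b]` and has finite `r`-variation there. -/
def MemV {F : Type*} [Sub F] (N : F → ℝ≥0∞) (r a b : ℝ) (u : ℝ → F) : Prop :=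
  (∀ t ∈ Icc a b, N (u t) < ∞) ∧ rVariation N r a b u < ∞

/-- The occupation measure `μ_{s,t} = ∫_s^t δ_{ω_τ} dτ`, that is
`μ_{s,t}(A) = |{τ ∈ (s, t] : ω_τ ∈ A}|`. -/
def occMeasure {d : ℕ} (ω : ℝ → Rd d) (s t : ℝ) : Measure (Rd d) :=
  (volume.restrict (Ioc s t)).map ω

instance occMeasure_isFiniteMeasure {d : ℕ} (ω : ℝ → Rd d) (s t : ℝ) :
    IsFiniteMeasure (occMeasure ω s t) := by
  unfold occMeasure; infer_instance

/-- The occupation measure as a tempered distribution. -/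
def occ {d : ℕ} (ω : ℝ → Rd d) (s t : ℝ) : 𝓢'(Rd d, ℂ) :=
  (occMeasure ω s t).toTemperedDistribution

end OccBesov

end

open Filter Topology
open scoped FourierTransform

namespace OccBesov

/-! ### Sequence norms -/

/-! Adding a constant to the path translates its occupation measure, so `μ^f` is a nonlinear Young
integral: over a partition, the germ on `[u, v]` is `μ_{u,v}` translated by `f u`. Additivity of `μ`
turns the defect of the germ at `m` into the difference of two translates of `μ_{m,v}`, by `f m` and
by `f u`. In Besov spaces such a difference costs `γ` derivatives and gains `|f m - f u| ^ γ`
(`exists_fieldNorm_translate_le`), so the defect is bounded by a product of controls with exponents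
`γ / r₁` and `1 / r`. The hypothesis on `γ` says exactly that these add up to more than `1`.

The paths may jump, so the controls need not be small on short intervals and sewing is not used to
produce a limit. It only gives bounds on Riemann sums that are uniform in the partition (`sewing`,
`exists_young_const`). The limit is found separately: a path of finite variation has countably many
discontinuities, so each Littlewood--Paley block of the Riemann sums converges pointwise by
dominated convergence (`tendsto_riemann_blockField`). The uniform bound passes to the limit by Fatou
(`besovNorm_le_of_tendsto`), and superadditivity of the control of `μ` turns bounds on increments
into bounds on variation (`rVariation_le_of_increment_le`).

For the difference of two perturbations the germ is the difference of the two germs, and its defect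
is a second-order difference of translates, which costs one more derivative. The essential supremum
of `f - g` controls its values only almost everywhere; hence the partition points are taken in a set
of full measure (`exists_partitions`), and controls and sewing are relative to a set `S` of
admissible points. -/

theorem seqNorm_mono {q : ℝ≥0∞} {c c' : ℕ → ℝ≥0∞} (h : ∀ j, c j ≤ c' j) :
    seqNorm q c ≤ seqNorm q c' := by
  unfold seqNorm
  split_ifs
  · exact iSup_mono h
  · gcongr
    exact h _

theorem seqNorm_add_le {q : ℝ≥0∞} (hq : 1 ≤ q) (c c' : ℕ → ℝ≥0∞) :
    seqNorm q (fun j => c j + c' j) ≤ seqNorm q c + seqNorm q c' := by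
  unfold seqNorm
  split_ifs with h
  · exact iSup_le fun j => add_le_add (le_iSup c j) (le_iSup c' j)
  · have h1 : 1 ≤ q.toReal := by
      simpa using (ENNReal.toReal_le_toReal ENNReal.one_ne_top h).2 hq
    simpa [lintegral_count] using
      ENNReal.lintegral_Lp_add_le (μ := Measure.count) (f := c) (g := c')
        (Measurable.of_discrete).aemeasurable (Measurable.of_discrete).aemeasurable h1

theorem seqNorm_const_mul {q : ℝ≥0∞} (hq : 1 ≤ q) (C : ℝ≥0∞) (c : ℕ → ℝ≥0∞) :
    seqNorm q (fun j => C * c j) = C * seqNorm q c := by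
  unfold seqNorm
  split_ifs with h
  · rw [ENNReal.mul_iSup]
  · have h1 : 0 < q.toReal := ENNReal.toReal_pos (zero_lt_one.trans_le hq).ne' h
    simp_rw [ENNReal.mul_rpow_of_nonneg _ _ h1.le]
    rw [ENNReal.tsum_mul_left, ENNReal.mul_rpow_of_nonneg _ _ (by positivity),
      ← ENNReal.rpow_mul, mul_one_div_cancel h1.ne', ENNReal.rpow_one]

theorem seqNorm_zero {q : ℝ≥0∞} (hq : 1 ≤ q) : seqNorm q (fun _ => 0) = 0 := by
  simpa using seqNorm_const_mul hq 0 (fun _ => 0)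

/-- Fatou's lemma for the counting measure. For `q = ∞` each coordinate is bounded separately. -/
theorem seqNorm_le_of_le_liminf {q M : ℝ≥0∞} (hq : 1 ≤ q) {c : ℕ → ℝ≥0∞} {cn : ℕ → ℕ → ℝ≥0∞}
    (h : ∀ j, c j ≤ liminf (fun n => cn n j) atTop) (hM : ∀ n, seqNorm q (cn n) ≤ M) :
    seqNorm q c ≤ M := by
  unfold seqNorm at *
  split_ifs at * with hq'
  · refine iSup_le fun j => (h j).trans ?_
    refine liminf_le_of_frequently_le' (Frequently.of_forall fun n => ?_)
    exact (le_iSup (cn n) j).trans (hM n)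
  · have h1 : 0 < q.toReal := ENNReal.toReal_pos (zero_lt_one.trans_le hq).ne' hq'
    have h2 : ∑' j, c j ^ q.toReal ≤ M ^ q.toReal := by
      calc ∑' j, c j ^ q.toReal ≤ ∑' j, liminf (fun n => cn n j ^ q.toReal) atTop := by
            refine ENNReal.tsum_le_tsum fun j => ?_
            refine (ENNReal.rpow_le_rpow (h j) h1.le).trans_eq ?_
            exact (ENNReal.orderIsoRpow q.toReal h1).liminf_apply
        _ ≤ liminf (fun n => ∑' j, cn n j ^ q.toReal) atTop := by
            simpa [lintegral_count] using lintegral_liminf_le (μ := Measure.count)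
              (f := fun n j => cn n j ^ q.toReal) (fun n => Measurable.of_discrete)
        _ ≤ M ^ q.toReal := by
            refine liminf_le_of_frequently_le' (Frequently.of_forall fun n => ?_)
            have := ENNReal.rpow_le_rpow (hM n) h1.le
            rwa [← ENNReal.rpow_mul, one_div_mul_cancel h1.ne', ENNReal.rpow_one] at this
    have := ENNReal.rpow_le_rpow h2 (one_div_nonneg.2 h1.le)
    rwa [← ENNReal.rpow_mul, mul_one_div_cancel h1.ne', ENNReal.rpow_one] at this

/-! ### The variation as a superadditive control -/

/-- The `r`-th power of the `r`-variation. -/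
noncomputable def varControl {F : Type*} [Sub F] (N : F → ℝ≥0∞) (r : ℝ) (u : ℝ → F) (a b : ℝ) :
    ℝ≥0∞ :=
  ⨆ P : ℕ × {t : ℕ → ℝ // Monotone t ∧ ∀ i, t i ∈ Icc a b},
    ∑ i ∈ Finset.range P.1, N (u (P.2.1 (i + 1)) - u (P.2.1 i)) ^ r

theorem rVariation_eq {F : Type*} [Sub F] (N : F → ℝ≥0∞) (r a b : ℝ) (u : ℝ → F) :
    rVariation N r a b u = varControl N r u a b ^ (1 / r) := rfl

theorem varControl_mono {F : Type*} [Sub F] (N : F → ℝ≥0∞) (r : ℝ) (u : ℝ → F) {a b a' b' : ℝ}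
    (ha : a' ≤ a) (hb : b ≤ b') : varControl N r u a b ≤ varControl N r u a' b' := by
  refine iSup_le fun P => ?_
  exact le_iSup_of_le (⟨P.1, P.2.1, P.2.2.1, fun i => Icc_subset_Icc ha hb (P.2.2.2 i)⟩ :
    ℕ × {t : ℕ → ℝ // Monotone t ∧ ∀ i, t i ∈ Icc a' b'}) le_rfl

theorem le_varControl {F : Type*} [Sub F] (N : F → ℝ≥0∞) (r : ℝ) (u : ℝ → F) {s t : ℝ}
    (h : s ≤ t) : N (u t - u s) ^ r ≤ varControl N r u s t := by
  refine le_iSup_of_le (⟨1, fun i => if i = 0 then s else t, ?_, ?_⟩ :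
    ℕ × {t' : ℕ → ℝ // Monotone t' ∧ ∀ i, t' i ∈ Icc s t}) (by simp)
  · intro i j hij
    rcases eq_or_ne i 0 with rfl | hi
    · by_cases hj : j = 0 <;> simp [hj, h]
    · have : j ≠ 0 := by omega
      simp [hi, this]
  · intro i
    by_cases hi : i = 0 <;> simp [hi, h]

theorem varControl_add_le {F : Type*} [Sub F] (N : F → ℝ≥0∞) (r : ℝ) (u : ℝ → F) {s m t : ℝ}
    (h1 : s ≤ m) (h2 : m ≤ t) :
    varControl N r u s m + varControl N r u m t ≤ varControl N r u s t := by
  have hne : ∀ x y : ℝ, x ≤ y → Nonempty (ℕ × {t : ℕ → ℝ // Monotone t ∧ ∀ i, t i ∈ Icc x y}) :=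
    fun x y hxy => ⟨0, fun _ => x, monotone_const, fun _ => ⟨le_rfl, hxy⟩⟩
  have := hne s m h1
  have := hne m t h2
  refine ENNReal.iSup_add_iSup_le fun P Q => ?_
  obtain ⟨n, p, hp, hpm⟩ := P
  obtain ⟨k, p', hp', hpm'⟩ := Q
  -- The two sequences are concatenated, which gives `n + 1 + k` increments. The one joining `p n`
  -- to `p' 0` is extra and is discarded.
  refine le_trans ?_ (le_iSup (fun P : ℕ × {t' : ℕ → ℝ // Monotone t' ∧ ∀ i, t' i ∈ Icc s t} =>
    ∑ i ∈ Finset.range P.1, N (u (P.2.1 (i + 1)) - u (P.2.1 i)) ^ r)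
    ⟨n + 1 + k, fun i => if i ≤ n then p i else p' (i - (n + 1)), ?_, ?_⟩)
  · simp only
    rw [Finset.sum_range_add, Finset.sum_range_succ]
    refine add_le_add (le_trans (le_of_eq ?_) le_self_add) (le_of_eq ?_)
    · refine Finset.sum_congr rfl fun i hi => ?_
      have hi := Finset.mem_range.1 hi
      rw [if_pos (by omega), if_pos (by omega)]
    · refine Finset.sum_congr rfl fun i hi => ?_
      rw [if_neg (by omega), if_neg (by omega)]
      congr 4 <;> congr 1 <;> omega
  · intro i j hij
    simp only
    split_ifs with hi hj hj
    · exact hp hij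
    · exact (hpm i).2.trans (hpm' _).1
    · omega
    · exact hp' (by omega)
  · intro i
    simp only
    split_ifs
    · exact ⟨(hpm i).1, (hpm i).2.trans h2⟩
    · exact ⟨h1.trans (hpm' _).1, (hpm' _).2⟩

/-- Superadditive functions of intervals with endpoints in `S`. -/
def IsControl (S : Set ℝ) (w : ℝ → ℝ → ℝ≥0∞) : Prop :=
  ∀ s ∈ S, ∀ m ∈ S, ∀ t ∈ S, s ≤ m → m ≤ t → w s m + w m t ≤ w s t

theorem isControl_varControl {F : Type*} [Sub F] (N : F → ℝ≥0∞) (r : ℝ) (u : ℝ → F) (S : Set ℝ) :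
    IsControl S (varControl N r u) :=
  fun _ _ _ _ _ _ h1 h2 => varControl_add_le N r u h1 h2

theorem IsControl.sum_le {S : Set ℝ} {w : ℝ → ℝ → ℝ≥0∞} (hw : IsControl S w) {t : ℕ → ℝ}
    (ht : Monotone t) (htS : ∀ i, t i ∈ S) (n : ℕ) :
    ∑ i ∈ Finset.range n, w (t i) (t (i + 1)) ≤ w (t 0) (t n) := by
  induction n with
  | zero => simp
  | succ n ih =>
    rw [Finset.sum_range_succ]
    exact (add_le_add_left ih _).trans
      (hw _ (htS 0) _ (htS n) _ (htS (n + 1)) (ht (Nat.zero_le _)) (ht (Nat.le_succ _)))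

theorem IsControl.add {S : Set ℝ} {w w' : ℝ → ℝ → ℝ≥0∞} (hw : IsControl S w)
    (hw' : IsControl S w') : IsControl S (fun s t => w s t + w' s t) := by
  intro s hs m hm t ht h1 h2
  refine le_trans (le_of_eq ?_) (add_le_add (hw s hs m hm t ht h1 h2) (hw' s hs m hm t ht h1 h2))
  ring

theorem IsControl.const_mul {S : Set ℝ} {w : ℝ → ℝ → ℝ≥0∞} (hw : IsControl S w) (c : ℝ≥0∞) :
    IsControl S (fun s t => c * w s t) := by
  intro s hs m hm t ht h1 h2
  rw [← mul_add]
  exact mul_le_mul_right (hw s hs m hm t ht h1 h2) c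

theorem IsControl.rpow {S : Set ℝ} {w : ℝ → ℝ → ℝ≥0∞} (hw : IsControl S w) {x : ℝ} (hx : 1 ≤ x) :
    IsControl S (fun s t => w s t ^ x) := by
  intro s hs m hm t ht h1 h2
  exact (ENNReal.add_rpow_le_rpow_add _ _ hx).trans
    (ENNReal.rpow_le_rpow (hw s hs m hm t ht h1 h2) (by linarith))

/-- Hölder's inequality on a two-point space. It makes weighted geometric means of controls
superadditive. -/
theorem rpow_mul_rpow_add_le {x y : ℝ} (hx : 0 < x) (hy : 0 < y) (hxy : x + y = 1)
    (a b c d : ℝ≥0∞) : a ^ x * b ^ y + c ^ x * d ^ y ≤ (a + c) ^ x * (b + d) ^ y := by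
  have h : (x⁻¹).HolderConjugate y⁻¹ := by
    rw [Real.holderConjugate_iff]
    exact ⟨(one_lt_inv₀ hx).2 (by linarith), by simpa using hxy⟩
  have := ENNReal.inner_le_Lp_mul_Lq (Finset.univ : Finset (Fin 2)) ![a ^ x, c ^ x] ![b ^ y, d ^ y] h
  simpa [Fin.sum_univ_two, ← ENNReal.rpow_mul, hx.ne', hy.ne'] using this

theorem IsControl.rpow_mul_rpow {S : Set ℝ} {A B : ℝ → ℝ → ℝ≥0∞} (hA : IsControl S A)
    (hB : IsControl S B) {x y : ℝ} (hx : 0 < x) (hy : 0 < y) (hxy : x + y = 1) :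
    IsControl S (fun s t => A s t ^ x * B s t ^ y) := by
  intro s hs m hm t ht h1 h2
  exact (rpow_mul_rpow_add_le hx hy hxy _ _ _ _).trans
    (mul_le_mul' (ENNReal.rpow_le_rpow (hA s hs m hm t ht h1 h2) hx.le)
      (ENNReal.rpow_le_rpow (hB s hs m hm t ht h1 h2) hy.le))

/-! ### Discrete sewing -/

theorem exists_sewing_const {θ : ℝ} (hθ : 1 < θ) :
    ∃ K : ℝ≥0, 2 ≤ K ∧ ∀ x : ℝ≥0∞, 2 * (K * (x / 2) ^ θ) + 2 * x ^ θ ≤ K * x ^ θ := by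
  have hc : (2 : ℝ≥0) ^ (1 - θ) < 1 := by
    rw [← NNReal.coe_lt_coe]
    simpa using Real.rpow_lt_one_of_one_lt_of_neg one_lt_two (by linarith)
  set c := (2 : ℝ≥0) ^ (1 - θ) with hcdef
  have hc' : 0 < 1 - c := tsub_pos_of_lt hc
  -- Bisection leads to the recursion `K = 2 ^ (1 - θ) * K + 2`, and `K` is its fixed point. It is
  -- finite because `θ > 1`.
  have hK : c * (2 / (1 - c)) + 2 = 2 / (1 - c) := by
    have : c + (1 - c) = 1 := add_tsub_cancel_of_le hc.le
    calc c * (2 / (1 - c)) + 2 = c * (2 / (1 - c)) + (1 - c) * (2 / (1 - c)) := by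
          rw [mul_div_cancel₀ _ hc'.ne']
      _ = (c + (1 - c)) * (2 / (1 - c)) := by ring
      _ = 2 / (1 - c) := by rw [this, one_mul]
  refine ⟨2 / (1 - c), ?_, fun x => ?_⟩
  · rw [← hK]; exact le_add_self
  · have hx : 2 * (x / 2) ^ θ = (c : ℝ≥0∞) * x ^ θ := by
      rw [ENNReal.div_rpow_of_nonneg _ _ (by linarith), hcdef, ENNReal.coe_rpow_of_ne_zero (by simp),
        ENNReal.rpow_sub _ _ (by simp) (by simp), ENNReal.rpow_one]
      simp only [div_eq_mul_inv, ENNReal.coe_ofNat]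
      ring
    have hK' : (c : ℝ≥0∞) * (2 / (1 - c) : ℝ≥0) + 2 = (2 / (1 - c) : ℝ≥0) := by
      exact_mod_cast congrArg ((↑) : ℝ≥0 → ℝ≥0∞) hK
    refine le_of_eq ?_
    calc _ = ((2 / (1 - c) : ℝ≥0) : ℝ≥0∞) * (2 * (x / 2) ^ θ) + 2 * x ^ θ := by ring
      _ = ((c : ℝ≥0∞) * (2 / (1 - c) : ℝ≥0) + 2) * x ^ θ := by rw [hx]; ring
      _ = _ := by rw [hK']

/-- Instead of removing points one at a time, the partition is cut where the control reaches half
its total. Each side then carries at most `W / 2`, and reassembling costs two defects. No continuity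
of `w` is needed, as the interval that crosses the halfway mark is treated on its own. -/
theorem sewing {F : Type*} [AddCommGroup F] {N : F → ℝ≥0∞} (h0 : N 0 = 0)
    (hadd : ∀ x y, N (x + y) ≤ N x + N y) {θ : ℝ} (hθ : 1 < θ) {K : ℝ≥0} (hK2 : 2 ≤ K)
    (hK : ∀ x : ℝ≥0∞, 2 * (K * (x / 2) ^ θ) + 2 * x ^ θ ≤ K * x ^ θ)
    {S : Set ℝ} {w : ℝ → ℝ → ℝ≥0∞} (hw : IsControl S w) {Ξ : ℝ → ℝ → F}
    (hΞ0 : ∀ s ∈ S, Ξ s s = 0)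
    (hΞ : ∀ s ∈ S, ∀ m ∈ S, ∀ t ∈ S, s ≤ m → m ≤ t →
      N (Ξ s m + Ξ m t - Ξ s t) ≤ w s t ^ θ) (n : ℕ) :
    ∀ t : ℕ → ℝ, Monotone t → (∀ i, t i ∈ S) →
      N (∑ i ∈ Finset.range n, Ξ (t i) (t (i + 1)) - Ξ (t 0) (t n)) ≤ K * w (t 0) (t n) ^ θ := by
  have hθ0 : 0 < θ := by linarith
  induction n using Nat.strong_induction_on with
  | _ n ih =>
  intro t ht htS
  rcases Nat.eq_zero_or_pos n with rfl | hn
  · simp [hΞ0 _ (htS 0), h0]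
  set W := w (t 0) (t n) with hW
  rcases eq_or_ne W ∞ with hW' | hW'
  · rw [hW', ENNReal.top_rpow_of_pos hθ0, ENNReal.mul_top]
    · exact le_top
    · exact_mod_cast (two_pos.trans_le hK2).ne'
  have hc := fun i j k (hij : i ≤ j) (hjk : j ≤ k) =>
    hw (t i) (htS i) (t j) (htS j) (t k) (htS k) (ht hij) (ht hjk)
  -- Superadditivity forces a finite control to vanish on degenerate intervals, so `k = 0` is
  -- admissible in the search below.
  have h00 : w (t 0) (t 0) = 0 := by
    have := hc 0 0 n le_rfl hn.le
    simpa using (ENNReal.add_le_add_iff_right (c := 0) hW').1 (by simpa using this)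
  have hnn : w (t n) (t n) = 0 := by
    have := hc 0 n n hn.le le_rfl
    simpa using (ENNReal.add_le_add_iff_left (c := 0) hW').1 (by simpa using this)
  classical
  set P : ℕ → Prop := fun k => w (t 0) (t k) ≤ W / 2 with hP
  set k := Nat.findGreatest P (n - 1) with hk
  have hPk : w (t 0) (t k) ≤ W / 2 :=
    Nat.findGreatest_spec (P := P) (Nat.zero_le (n - 1)) (by simp [hP, h00])
  have hkn : k ≤ n - 1 := Nat.findGreatest_le _
  -- By maximality of `k` the interval from `t 0` to `t (k + 1)` carries more than half of `W`,
  -- which leaves at most half for the rest.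
  have hk2 : w (t (k + 1)) (t n) ≤ W / 2 := by
    rcases Nat.lt_or_ge (n - 1) (k + 1) with h | h
    · rw [show k + 1 = n by omega, hnn]; exact zero_le
    · have h3 : W / 2 < w (t 0) (t (k + 1)) :=
        not_le.1 (Nat.findGreatest_is_greatest (P := P) (Nat.lt_succ_self k) h)
      have h4 := hc 0 (k + 1) n (Nat.zero_le _) (by omega)
      by_contra! h5
      have := ENNReal.add_lt_add h3 h5
      rw [ENNReal.add_halves] at this
      exact absurd h4 (not_le.2 this)
  obtain ⟨m, hm⟩ : ∃ m, n = k + 1 + m := ⟨n - (k + 1), by omega⟩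
  have e1 := ih k (by omega) t ht htS
  have e2 := ih m (by omega) (fun i => t (k + 1 + i))
    (fun i j hij => ht (by omega)) (fun i => htS _)
  simp only [Nat.add_zero, ← hm] at e2
  have d1 := hΞ (t 0) (htS _) (t k) (htS _) (t n) (htS _) (ht (by omega)) (ht (by omega))
  have d2 := hΞ (t k) (htS _) (t (k + 1)) (htS _) (t n) (htS _) (ht (by omega)) (ht (by omega))
  have hwk : w (t k) (t n) ≤ W := le_add_self.trans (hc 0 k n (by omega) (by omega))
  have hsum : ∑ x ∈ Finset.range n, Ξ (t x) (t (x + 1)) =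
      ∑ x ∈ Finset.range k, Ξ (t x) (t (x + 1)) + Ξ (t k) (t (k + 1)) +
      ∑ x ∈ Finset.range m, Ξ (t (k + 1 + x)) (t (k + 1 + x + 1)) := by
    rw [hm, Finset.sum_range_add, Finset.sum_range_succ]
  have heq : ∑ x ∈ Finset.range n, Ξ (t x) (t (x + 1)) - Ξ (t 0) (t n) =
      (∑ x ∈ Finset.range k, Ξ (t x) (t (x + 1)) - Ξ (t 0) (t k)) +
      (∑ x ∈ Finset.range m, Ξ (t (k + 1 + x)) (t (k + 1 + x + 1)) - Ξ (t (k + 1)) (t n)) +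
      ((Ξ (t 0) (t k) + Ξ (t k) (t n) - Ξ (t 0) (t n)) +
      (Ξ (t k) (t (k + 1)) + Ξ (t (k + 1)) (t n) - Ξ (t k) (t n))) := by
    rw [hsum]; abel
  rw [heq]
  refine le_trans ?_ (hK W)
  refine (hadd _ _).trans (add_le_add ((hadd _ _).trans ?_) ((hadd _ _).trans ?_))
  · rw [two_mul]
    refine add_le_add (e1.trans ?_) (e2.trans ?_) <;> gcongr
  · rw [two_mul]
    refine add_le_add d1 (d2.trans ?_)
    gcongr

/-- The defect bound is the power `x + y > 1` of a single control, a geometric mean of `A` and `B`,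
so `sewing` applies. The constant depends only on the exponents. -/
theorem exists_young_const {x y : ℝ} (hx : 0 < x) (hy : 0 < y) (hxy : 1 < x + y) :
    ∃ K : ℝ≥0, ∀ {F : Type} [AddCommGroup F] {N : F → ℝ≥0∞} (_ : N 0 = 0)
    (_ : ∀ x y, N (x + y) ≤ N x + N y)
    {S : Set ℝ} {A B : ℝ → ℝ → ℝ≥0∞} (_ : IsControl S A) (_ : IsControl S B) {Ξ : ℝ → ℝ → F}
    {c C : ℝ≥0∞}
    (_ : ∀ s ∈ S, Ξ s s = 0)
    (_ : ∀ s ∈ S, ∀ t ∈ S, s ≤ t → N (Ξ s t) ≤ c * B s t ^ y)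
    (_ : ∀ s ∈ S, ∀ m ∈ S, ∀ t ∈ S, s ≤ m → m ≤ t →
      N (Ξ s m + Ξ m t - Ξ s t) ≤ C * A s m ^ x * B m t ^ y) (n : ℕ)
    (t : ℕ → ℝ) (_ : Monotone t) (_ : ∀ i, t i ∈ S),
      N (∑ i ∈ Finset.range n, Ξ (t i) (t (i + 1))) ≤
        (c + K * (C * A (t 0) (t n) ^ x)) * B (t 0) (t n) ^ y := by
  obtain ⟨K, hK2, hK⟩ := exists_sewing_const hxy
  refine ⟨K, ?_⟩
  intro F _ N h0 hadd S A B hA hB Ξ c C hΞ0 hΞc hΞ n t ht htS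
  have hθ : 0 < x + y := by linarith
  -- The factor `C` is absorbed into the control as `C ^ x⁻¹`, so that it comes out of the sewing
  -- bound linearly.
  have hpow : ∀ a b : ℝ≥0∞, ((C ^ x⁻¹ * a) ^ (x / (x + y)) * b ^ (y / (x + y))) ^ (x + y) =
      C * a ^ x * b ^ y := by
    intro a b
    rw [ENNReal.mul_rpow_of_nonneg _ _ hθ.le, ← ENNReal.rpow_mul, ← ENNReal.rpow_mul,
      div_mul_cancel₀ _ hθ.ne', div_mul_cancel₀ _ hθ.ne', ENNReal.mul_rpow_of_nonneg _ _ hx.le,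
      ← ENNReal.rpow_mul, inv_mul_cancel₀ hx.ne', ENNReal.rpow_one]
  have hw := (hA.const_mul (C ^ x⁻¹)).rpow_mul_rpow hB (x := x / (x + y)) (y := y / (x + y))
    (by positivity) (by positivity) (by field_simp)
  have := sewing h0 hadd hxy hK2 hK hw hΞ0 (fun s hs m hm u hu h1 h2 => by
    rw [hpow]
    refine (hΞ s hs m hm u hu h1 h2).trans ?_
    gcongr
    · exact le_self_add.trans (hA s hs m hm u hu h1 h2)
    · exact le_add_self.trans (hB s hs m hm u hu h1 h2)) n t ht htS
  rw [hpow] at this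
  have h3 := hadd (∑ i ∈ Finset.range n, Ξ (t i) (t (i + 1)) - Ξ (t 0) (t n)) (Ξ (t 0) (t n))
  rw [sub_add_cancel] at h3
  refine h3.trans ?_
  rw [add_mul, add_comm, mul_assoc (K : ℝ≥0∞)]
  exact add_le_add (hΞc _ (htS _) _ (htS _) (ht (Nat.zero_le _))) this

/-! ### Young's inequality for convolutions -/

/-- Hölder's inequality after splitting the weight `κ` into its powers `1 - 1 / r` and `1 / r`. -/
theorem lintegral_mul_rpow_le {X : Type*} [MeasurableSpace X] {μ : Measure X} {r : ℝ} (hr : 1 < r)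
    {κ f : X → ℝ≥0∞} (hκ : Measurable κ) (hf : Measurable f) :
    (∫⁻ x, κ x * f x ∂μ) ^ r ≤ (∫⁻ x, κ x ∂μ) ^ (r - 1) * ∫⁻ x, κ x * f x ^ r ∂μ := by
  have hr0 : 0 < r := by linarith
  have hc : (r / (r - 1)).HolderConjugate r := (Real.HolderConjugate.conjExponent hr).symm
  have h1 : 0 < r - 1 := by linarith
  have hx : 0 ≤ (r / (r - 1))⁻¹ := by positivity
  have hxy : (r / (r - 1))⁻¹ + r⁻¹ = 1 := hc.inv_add_inv_eq_one
  have key := ENNReal.lintegral_mul_le_Lp_mul_Lq μ hc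
    (f := fun x => κ x ^ (r / (r - 1))⁻¹) (g := fun x => κ x ^ r⁻¹ * f x)
    (hκ.pow_const _).aemeasurable ((hκ.pow_const _).mul hf).aemeasurable
  have e1 : ∀ x, κ x ^ (r / (r - 1))⁻¹ * (κ x ^ r⁻¹ * f x) = κ x * f x := fun x => by
    rw [← mul_assoc, ← ENNReal.rpow_add_of_nonneg _ _ hx (by positivity), hxy, ENNReal.rpow_one]
  have e2 : ∀ x, (κ x ^ (r / (r - 1))⁻¹) ^ (r / (r - 1)) = κ x := fun x => by
    rw [← ENNReal.rpow_mul, inv_mul_cancel₀ (by positivity), ENNReal.rpow_one]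
  have e3 : ∀ x, (κ x ^ r⁻¹ * f x) ^ r = κ x * f x ^ r := fun x => by
    rw [ENNReal.mul_rpow_of_nonneg _ _ hr0.le, ← ENNReal.rpow_mul, inv_mul_cancel₀ hr0.ne',
      ENNReal.rpow_one]
  simp only [Pi.mul_apply, e1, e2, e3] at key
  refine (ENNReal.rpow_le_rpow key hr0.le).trans_eq ?_
  rw [ENNReal.mul_rpow_of_nonneg _ _ hr0.le, ← ENNReal.rpow_mul, ← ENNReal.rpow_mul,
    one_div_mul_cancel hr0.ne', ENNReal.rpow_one]
  congr 2
  field_simp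

theorem eLpNorm_integral_mul_sub_le {d : ℕ} {p : ℝ≥0∞} (hp : 1 < p) (hp' : p < ∞)
    {k u : Rd d → ℂ} (hk : Measurable k) (hu : Measurable u) :
    eLpNorm (fun x => ∫ z, k z * u (x - z)) p volume ≤ (∫⁻ z, ‖k z‖ₑ) * eLpNorm u p volume := by
  have hp0 : p ≠ 0 := (zero_lt_one.trans hp).ne'
  have hr : 1 < p.toReal := by
    simpa using (ENNReal.toReal_lt_toReal ENNReal.one_ne_top hp'.ne).2 hp
  set r := p.toReal with hrdef
  have hr0 : 0 < r := by linarith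
  rw [eLpNorm_eq_lintegral_rpow_enorm_toReal hp0 hp'.ne,
    eLpNorm_eq_lintegral_rpow_enorm_toReal hp0 hp'.ne, ← hrdef]
  have h1 : ∀ x, ‖∫ z, k z * u (x - z)‖ₑ ^ r ≤
      (∫⁻ z, ‖k z‖ₑ) ^ (r - 1) * ∫⁻ z, ‖k z‖ₑ * ‖u (x - z)‖ₑ ^ r := fun x => by
    refine le_trans (ENNReal.rpow_le_rpow ?_ hr0.le)
      (lintegral_mul_rpow_le hr hk.enorm (hu.comp (measurable_const.sub measurable_id)).enorm)
    refine (enorm_integral_le_lintegral_enorm _).trans_eq ?_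
    simp [enorm_mul]
  have hm : Measurable fun q : Rd d × Rd d => ‖k q.2‖ₑ * ‖u (q.1 - q.2)‖ₑ ^ r :=
    (hk.comp measurable_snd).enorm.mul
      ((hu.comp (measurable_fst.sub measurable_snd)).enorm.pow_const _)
  have h2 : ∫⁻ x, ‖∫ z, k z * u (x - z)‖ₑ ^ r ≤ (∫⁻ z, ‖k z‖ₑ) ^ r * ∫⁻ x, ‖u x‖ₑ ^ r := by
    refine (lintegral_mono h1).trans_eq ?_
    rw [lintegral_const_mul _ hm.lintegral_prod_right', lintegral_lintegral_swap hm.aemeasurable]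
    have : ∀ z, ∫⁻ x, ‖k z‖ₑ * ‖u (x - z)‖ₑ ^ r = ‖k z‖ₑ * ∫⁻ x, ‖u x‖ₑ ^ r := fun z => by
      have hmz : Measurable fun x => ‖u (x - z)‖ₑ ^ r :=
        (hu.comp (measurable_id.sub_const z)).enorm.pow_const _
      rw [lintegral_const_mul _ hmz,
        lintegral_sub_right_eq_self (fun x => ‖u x‖ₑ ^ r) z]
    simp_rw [this]
    rw [lintegral_mul_const _ hk.enorm, ← mul_assoc]
    congr 1
    nth_rewrite 2 [← ENNReal.rpow_one (∫⁻ z, ‖k z‖ₑ)]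
    rw [← ENNReal.rpow_add_of_nonneg _ _ (by linarith) zero_le_one, sub_add_cancel]
  refine (ENNReal.rpow_le_rpow h2 (by positivity)).trans_eq ?_
  rw [ENNReal.mul_rpow_of_nonneg _ _ (by positivity), ← ENNReal.rpow_mul,
    mul_one_div_cancel hr0.ne', ENNReal.rpow_one]

/-! ### Translations of Schwartz functions in `L¹` -/

/-- The increment is the integral of the derivative along a segment; Tonelli and translation
invariance do the rest. -/
theorem lintegral_enorm_translate_sub_le {d : ℕ} (Ψ : 𝓢(Rd d, ℂ)) (h : Rd d) :
    ∫⁻ z, ‖Ψ (z - h) - Ψ z‖ₑ ≤ (∫⁻ z, ‖fderiv ℝ Ψ z‖ₑ) * ‖h‖ₑ := by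
  have hc : Continuous (fderiv ℝ Ψ) := (Ψ.smooth 1).continuous_fderiv one_ne_zero
  have h1 : ∀ z, ‖Ψ (z - h) - Ψ z‖ₑ ≤
      ∫⁻ θ in Ioc (0 : ℝ) 1, ‖fderiv ℝ Ψ (z - θ • h)‖ₑ * ‖h‖ₑ := fun z => by
    have hd : ∀ θ : ℝ, HasDerivAt (fun θ : ℝ => Ψ (z - θ • h)) (fderiv ℝ Ψ (z - θ • h) (-h)) θ := by
      intro θ
      have h2 : HasDerivAt (fun θ : ℝ => z - θ • h) (-h) θ := by
        simpa using ((hasDerivAt_id θ).smul_const h).const_sub z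
      exact (Ψ.differentiable.differentiableAt.hasFDerivAt).comp_hasDerivAt θ h2
    have := intervalIntegral.integral_eq_sub_of_hasDerivAt (a := 0) (b := 1) (fun θ _ => hd θ)
      ((by fun_prop : Continuous fun θ : ℝ => fderiv ℝ Ψ (z - θ • h) (-h)).intervalIntegrable _ _)
    simp only [one_smul, zero_smul, sub_zero] at this
    rw [← this, intervalIntegral.integral_of_le zero_le_one]
    refine (enorm_integral_le_lintegral_enorm _).trans (lintegral_mono fun θ => ?_)
    simpa using ContinuousLinearMap.le_opENorm (fderiv ℝ Ψ (z - θ • h)) (-h)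
  refine (lintegral_mono h1).trans_eq ?_
  have hm : Measurable fun q : Rd d × ℝ => ‖fderiv ℝ Ψ (q.1 - q.2 • h)‖ₑ * ‖h‖ₑ :=
    ((by fun_prop : Continuous fun q : Rd d × ℝ => fderiv ℝ Ψ (q.1 - q.2 • h)).measurable.enorm
      ).mul_const _
  rw [lintegral_lintegral_swap hm.aemeasurable]
  have : ∀ θ : ℝ, ∫⁻ z, ‖fderiv ℝ Ψ (z - θ • h)‖ₑ * ‖h‖ₑ = (∫⁻ z, ‖fderiv ℝ Ψ z‖ₑ) * ‖h‖ₑ := by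
    intro θ
    have hmθ : Measurable fun z => ‖fderiv ℝ Ψ (z - θ • h)‖ₑ :=
      (hc.comp (continuous_id.sub continuous_const)).measurable.enorm
    rw [lintegral_mul_const _ hmθ,
      lintegral_sub_right_eq_self (fun z => ‖fderiv ℝ Ψ z‖ₑ)]
  simp [this]

/-- For `|h| ≤ 1` the derivative bound suffices since `|h| ≤ |h| ^ γ`; for `|h| ≥ 1` the triangle
inequality does. The constant is uniform in `γ`. -/
theorem exists_lintegral_translate_sub_le {d : ℕ} (Ψ : 𝓢(Rd d, ℂ)) :
    ∃ C : ℝ≥0, ∀ γ : ℝ, 0 ≤ γ → γ ≤ 1 → ∀ h : Rd d,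
      ∫⁻ z, ‖Ψ (z - h) - Ψ z‖ₑ ≤ C * ‖h‖ₑ ^ γ := by
  have h1 : ∫⁻ z, ‖Ψ z‖ₑ ≠ ∞ := Ψ.integrable.2.ne
  have h2 : ∫⁻ z, ‖fderiv ℝ Ψ z‖ₑ ≠ ∞ := ((SchwartzMap.fderivCLM ℝ (Rd d) ℂ Ψ).integrable).2.ne
  refine ⟨(2 * ∫⁻ z, ‖Ψ z‖ₑ).toNNReal + (∫⁻ z, ‖fderiv ℝ Ψ z‖ₑ).toNNReal, fun γ hγ hγ1 h => ?_⟩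
  rw [ENNReal.coe_add, ENNReal.coe_toNNReal h2,
    ENNReal.coe_toNNReal (ENNReal.mul_ne_top (by simp) h1), add_mul]
  rcases le_total ‖h‖ₑ 1 with hh | hh
  · refine ((lintegral_enorm_translate_sub_le Ψ h).trans ?_).trans le_add_self
    gcongr
    simpa using ENNReal.rpow_le_rpow_of_exponent_ge hh hγ1
  · refine le_trans ?_ le_self_add
    calc ∫⁻ z, ‖Ψ (z - h) - Ψ z‖ₑ ≤ ∫⁻ z, (‖Ψ (z - h)‖ₑ + ‖Ψ z‖ₑ) :=
          lintegral_mono fun z => enorm_sub_le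
      _ = 2 * ∫⁻ z, ‖Ψ z‖ₑ := by
          rw [lintegral_add_right _ Ψ.continuous.measurable.enorm,
            lintegral_sub_right_eq_self (fun z => ‖Ψ z‖ₑ), two_mul]
      _ ≤ _ := by
          refine le_mul_of_one_le_right' ?_
          simpa using ENNReal.rpow_le_rpow hh hγ

/-! ### Littlewood--Paley kernels -/

theorem cutoff_contDiff (d : ℕ) : ContDiff ℝ (⊤ : ℕ∞) (cutoff d) := ContDiffBump.contDiff _

theorem cutoff_hasCompactSupport (d : ℕ) : HasCompactSupport (cutoff d) :=
  ContDiffBump.hasCompactSupport _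

theorem cutoff_eq_one {d : ℕ} {ξ : Rd d} (h : ‖ξ‖ ≤ 1) : cutoff d ξ = 1 :=
  ContDiffBump.one_of_mem_closedBall _ (by simpa using h)

theorem cutoff_eq_zero {d : ℕ} {ξ : Rd d} (h : 2 ≤ ‖ξ‖) : cutoff d ξ = 0 :=
  ContDiffBump.zero_of_le_dist _ (by simpa using h)

/-- The dilated cut-off `ξ ↦ χ(2^{-k} ξ)` as a Schwartz function. -/
noncomputable def cutoffSchwartz (d k : ℕ) : 𝓢(Rd d, ℂ) :=
  HasCompactSupport.toSchwartzMap (f := fun ξ : Rd d => (cutoff d (((2 : ℝ) ^ k)⁻¹ • ξ) : ℂ))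
    (((cutoff_hasCompactSupport d).comp_smul (c := ((2 : ℝ) ^ k)⁻¹) (by positivity)).comp_left
      (g := fun x : ℝ => (x : ℂ)) (by simp))
    (Complex.ofRealCLM.contDiff.comp ((cutoff_contDiff d).comp (contDiff_const_smul _)))

@[simp]
theorem cutoffSchwartz_apply (d k : ℕ) (ξ : Rd d) :
    cutoffSchwartz d k ξ = (cutoff d (((2 : ℝ) ^ k)⁻¹ • ξ) : ℂ) := rfl

/-- The dyadic function as a Schwartz function. -/
noncomputable def dyadicSchwartz (d : ℕ) : ℕ → 𝓢(Rd d, ℂ)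
  | 0 => cutoffSchwartz d 0
  | j + 1 => cutoffSchwartz d (j + 1) - cutoffSchwartz d j

@[simp]
theorem dyadicSchwartz_apply (d j : ℕ) (ξ : Rd d) : dyadicSchwartz d j ξ = (dyadic d j ξ : ℂ) := by
  cases j <;> simp [dyadicSchwartz, dyadic]

/-- The dyadic function lives on `|ξ| ≤ 2 ^ (j + 1)`, where the cut-off dilated by `2 ^ (j + 1)`
equals `1`. This explains the index `j + 1` in `bandKernel`. -/
theorem dyadic_mul_cutoff (d j : ℕ) (ξ : Rd d) :
    dyadic d j ξ * cutoff d (((2 : ℝ) ^ (j + 1))⁻¹ • ξ) = dyadic d j ξ := by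
  have hn : ∀ k : ℕ, ‖((2 : ℝ) ^ k)⁻¹ • ξ‖ = ‖ξ‖ / 2 ^ k := fun k => by
    rw [norm_smul, norm_inv, norm_pow, Real.norm_two]; field_simp
  rcases le_total ‖ξ‖ (2 ^ (j + 1)) with h | h
  · rw [cutoff_eq_one, mul_one]
    rw [hn, div_le_one (by positivity)]
    exact h
  · have : dyadic d j ξ = 0 := by
      have hz : ∀ k ≤ j, cutoff d (((2 : ℝ) ^ k)⁻¹ • ξ) = 0 := fun k hk => by
        refine cutoff_eq_zero ?_
        rw [hn, le_div_iff₀ (by positivity), ← pow_succ']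
        exact (pow_le_pow_right₀ one_le_two (by omega)).trans h
      cases j with
      | zero => simpa [dyadic] using hz 0 le_rfl
      | succ j => simp only [dyadic, hz (j + 1) le_rfl, hz j (by omega), sub_zero]
    simp [this]

/-- The convolution kernel of the Littlewood--Paley block. -/
noncomputable def blockKernel (d j : ℕ) : 𝓢(Rd d, ℂ) := 𝓕⁻ (dyadicSchwartz d j)

/-- A kernel which reproduces functions with frequencies in the range of the `j`-th block. -/
noncomputable def bandKernel (d j : ℕ) : 𝓢(Rd d, ℂ) := 𝓕⁻ (cutoffSchwartz d (j + 1))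

theorem blockKernel_reproducing (d j : ℕ) (x : Rd d) :
    blockKernel d j x = ∫ z, bandKernel d j z * blockKernel d j (x - z) := by
  have h : blockKernel d j =
      SchwartzMap.convolution (ContinuousLinearMap.mul ℂ ℂ) (bandKernel d j) (blockKernel d j) := by
    have h1 : 𝓕 (blockKernel d j) = dyadicSchwartz d j := by simp [blockKernel]
    have h2 : 𝓕 (bandKernel d j) = cutoffSchwartz d (j + 1) := by simp [bandKernel]
    have h3 : SchwartzMap.pairing (ContinuousLinearMap.mul ℂ ℂ) (cutoffSchwartz d (j + 1))
        (dyadicSchwartz d j) = dyadicSchwartz d j := by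
      ext ξ
      simp only [SchwartzMap.pairing_apply_apply, ContinuousLinearMap.mul_apply',
        cutoffSchwartz_apply, dyadicSchwartz_apply]
      rw [mul_comm, ← Complex.ofReal_mul, dyadic_mul_cutoff]
    have h4 := SchwartzMap.fourier_convolution (ContinuousLinearMap.mul ℂ ℂ) (bandKernel d j)
      (blockKernel d j)
    rw [h1, h2, h3, ← h1] at h4
    have := congrArg (fun f : 𝓢(Rd d, ℂ) => 𝓕⁻ f) h4
    simpa using this.symm
  conv_lhs => rw [h]
  rw [SchwartzMap.convolution_apply]
  rfl

theorem fourierInv_cutoffSchwartz (d k : ℕ) (z : Rd d) :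
    (𝓕⁻ (cutoffSchwartz d k) : 𝓢(Rd d, ℂ)) z =
      ((2 : ℝ) ^ k) ^ d • (𝓕⁻ (cutoffSchwartz d 0) : 𝓢(Rd d, ℂ)) ((2 : ℝ) ^ k • z) := by
  simp only [SchwartzMap.fourierInv_coe, Real.fourierInv_eq, cutoffSchwartz_apply, pow_zero,
    inv_one, one_smul]
  have := Measure.integral_comp_smul (volume : Measure (Rd d))
    (fun ξ : Rd d => Real.fourierChar (inner ℝ ξ ((2 : ℝ) ^ k • z)) • (cutoff d ξ : ℂ))
    (((2 : ℝ) ^ k)⁻¹)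
  simp only [finrank_euclideanSpace, Fintype.card_fin, inner_smul_left, inner_smul_right] at this
  rw [inv_pow, inv_inv, abs_of_nonneg (by positivity)] at this
  simp only [inner_smul_right]
  rw [← this]
  refine integral_congr_ae (Eventually.of_forall fun ξ => ?_)
  simp

theorem exists_bandKernel_translate_le (d : ℕ) :
    ∃ C : ℝ≥0, ∀ γ : ℝ, 0 ≤ γ → γ ≤ 1 → ∀ (j : ℕ) (h : Rd d),
      ∫⁻ z, ‖bandKernel d j (z - h) - bandKernel d j z‖ₑ ≤
        C * ((2 : ℝ≥0∞) ^ ((j : ℝ) * γ) * ‖h‖ₑ ^ γ) := by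
  obtain ⟨C, hC⟩ := exists_lintegral_translate_sub_le (𝓕⁻ (cutoffSchwartz d 0) : 𝓢(Rd d, ℂ))
  -- The kernel lives at scale `2 ^ (j + 1)` rather than `2 ^ j`; the factor `2` absorbs the surplus
  -- `2 ^ γ`.
  refine ⟨2 * C, fun γ hγ hγ1 j h => ?_⟩
  set Ψ := (𝓕⁻ (cutoffSchwartz d 0) : 𝓢(Rd d, ℂ)) with hΨ
  set R : ℝ := 2 ^ (j + 1) with hR
  have hR0 : 0 < R := by positivity
  have e1 : ∫⁻ z, ‖bandKernel d j (z - h) - bandKernel d j z‖ₑ =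
      ∫⁻ z, ‖Ψ (z - R • h) - Ψ z‖ₑ := by
    have hi1 : Integrable fun z => bandKernel d j (z - h) - bandKernel d j z :=
      ((bandKernel d j).integrable.comp_sub_right h).sub (bandKernel d j).integrable
    have hi2 : Integrable fun z => Ψ (z - R • h) - Ψ z :=
      (Ψ.integrable.comp_sub_right _).sub Ψ.integrable
    rw [← ofReal_integral_norm_eq_lintegral_enorm hi1, ← ofReal_integral_norm_eq_lintegral_enorm hi2]
    congr 1
    have := Measure.integral_comp_smul (volume : Measure (Rd d))
      (fun z => ‖Ψ (z - R • h) - Ψ z‖) R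
    simp only [finrank_euclideanSpace, Fintype.card_fin] at this
    rw [abs_of_nonneg (by positivity), eq_inv_smul_iff₀ (by positivity), ← integral_smul] at this
    rw [← this]
    refine integral_congr_ae (Eventually.of_forall fun z => ?_)
    simp only [bandKernel, fourierInv_cutoffSchwartz d (j + 1), ← hR, ← hΨ]
    rw [← smul_sub, norm_smul, smul_sub, Real.norm_of_nonneg (by positivity)]
    rfl
  rw [e1]
  refine (hC γ hγ hγ1 (R • h)).trans ?_
  rw [enorm_smul, ENNReal.mul_rpow_of_nonneg _ _ hγ]
  have e2 : ‖R‖ₑ ^ γ ≤ 2 * (2 : ℝ≥0∞) ^ ((j : ℝ) * γ) := by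
    have : ‖R‖ₑ = 2 * (2 : ℝ≥0∞) ^ (j : ℝ) := by
      rw [hR, enorm_pow, pow_succ', ENNReal.rpow_natCast]
      congr 2 <;> simp [← ofReal_norm]
    rw [this, ENNReal.mul_rpow_of_nonneg _ _ hγ, ← ENNReal.rpow_mul]
    gcongr
    simpa using ENNReal.rpow_le_rpow_of_exponent_le (x := 2) (by norm_num) hγ1
  calc (C : ℝ≥0∞) * (‖R‖ₑ ^ γ * ‖h‖ₑ ^ γ)
      ≤ C * ((2 * (2 : ℝ≥0∞) ^ ((j : ℝ) * γ)) * ‖h‖ₑ ^ γ) := by gcongr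
    _ = _ := by push_cast; ring

/-! ### Band-limited functions -/

/-- Bounded continuous functions which are reproduced by the `j`-th band kernel. -/
structure IsBand (d j : ℕ) (u : Rd d → ℂ) : Prop where
  continuous : Continuous u
  bounded : ∃ M : ℝ, ∀ x, ‖u x‖ ≤ M
  reproducing : ∀ x, u x = ∫ z, bandKernel d j z * u (x - z)

namespace IsBand

variable {d j : ℕ} {u v : Rd d → ℂ}

theorem integrable_mul (hu : IsBand d j u) (k : 𝓢(Rd d, ℂ)) (x : Rd d) :
    Integrable fun z => k z * u (x - z) := by
  obtain ⟨M, hM⟩ := hu.bounded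
  exact k.integrable.mul_bdd (c := M)
    (hu.continuous.comp (continuous_const.sub continuous_id)).aestronglyMeasurable
    (Eventually.of_forall fun z => hM _)

theorem translate (hu : IsBand d j u) (h : Rd d) : IsBand d j fun x => u (x - h) where
  continuous := hu.continuous.comp (continuous_id.sub continuous_const)
  bounded := hu.bounded.imp fun M hM x => hM _
  reproducing x := by
    rw [hu.reproducing]
    simp_rw [sub_right_comm]

theorem sub (hu : IsBand d j u) (hv : IsBand d j v) : IsBand d j fun x => u x - v x where
  continuous := hu.continuous.sub hv.continuous
  bounded := by
    obtain ⟨M, hM⟩ := hu.bounded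
    obtain ⟨M', hM'⟩ := hv.bounded
    exact ⟨M + M', fun x => (norm_sub_le _ _).trans (add_le_add (hM x) (hM' x))⟩
  reproducing x := by
    rw [hu.reproducing, hv.reproducing x,
      ← integral_sub (hu.integrable_mul _ x) (hv.integrable_mul _ x)]
    simp_rw [mul_sub]

/-- Moves the translation from `u`, of which no smoothness is known quantitatively, to the explicit
kernel. -/
theorem translate_sub_eq (hu : IsBand d j u) (h x : Rd d) :
    u (x - h) - u x = ∫ z, (bandKernel d j (z - h) - bandKernel d j z) * u (x - z) := by
  have h1 : u (x - h) = ∫ z, bandKernel d j (z - h) * u (x - z) := by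
    rw [hu.reproducing, ← integral_sub_right_eq_self _ h]
    refine integral_congr_ae (Eventually.of_forall fun z => ?_)
    simp
  have hi : Integrable fun z => bandKernel d j (z - h) * u (x - z) := by
    have := (hu.integrable_mul (bandKernel d j) (x - h)).comp_sub_right h
    refine this.congr (Eventually.of_forall fun z => ?_)
    simp
  rw [h1, hu.reproducing x, ← integral_sub hi (hu.integrable_mul _ x)]
  simp_rw [sub_mul]

end IsBand

theorem exists_band_translate_le (d : ℕ) {p : ℝ≥0∞} (hp : 1 < p) (hp' : p < ∞) :
    ∃ C : ℝ≥0, ∀ γ : ℝ, 0 ≤ γ → γ ≤ 1 → ∀ (j : ℕ) (u : Rd d → ℂ), IsBand d j u → ∀ h : Rd d,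
      eLpNorm (fun x => u (x - h) - u x) p volume ≤
        C * ((2 : ℝ≥0∞) ^ ((j : ℝ) * γ) * ‖h‖ₑ ^ γ) * eLpNorm u p volume := by
  obtain ⟨C, hC⟩ := exists_bandKernel_translate_le d
  refine ⟨C, fun γ hγ hγ1 j u hu h => ?_⟩
  simp_rw [hu.translate_sub_eq h]
  refine (eLpNorm_integral_mul_sub_le hp hp'
    (k := fun z => bandKernel d j (z - h) - bandKernel d j z) ?_ hu.continuous.measurable).trans ?_
  · exact (((bandKernel d j).continuous.comp (continuous_id.sub continuous_const)).sub
      (bandKernel d j).continuous).measurable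
  · gcongr
    exact hC γ hγ hγ1 j h

/-! ### The norms on tempered distributions -/

section Norms

variable {d : ℕ} {p : ℝ≥0∞} [Fact (1 ≤ p)]

theorem distLpNorm_add_le (u v : 𝓢'(Rd d, ℂ)) :
    distLpNorm p (u + v) ≤ distLpNorm p u + distLpNorm p v := by
  unfold distLpNorm
  simp_rw [ENNReal.iInf_add, ENNReal.add_iInf]
  refine le_iInf fun h => le_iInf fun hh => le_iInf fun k => le_iInf fun hk => ?_
  refine (iInf₂_le (h + k) ?_).trans (enorm_add_le h k)
  have := (Lp.toTemperedDistributionCLM ℂ (volume : Measure (Rd d)) p).map_add h k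
  simpa [hh, hk] using this

theorem distLpNorm_zero : distLpNorm p (0 : 𝓢'(Rd d, ℂ)) = 0 := by
  refine le_antisymm ((iInf₂_le 0 ?_).trans (by simp)) zero_le
  simpa using (Lp.toTemperedDistributionCLM ℂ (volume : Measure (Rd d)) p).map_zero

theorem besovNorm_zero {α : ℝ} {q : ℝ≥0∞} (hq : 1 ≤ q) :
    besovNorm α p q (0 : 𝓢'(Rd d, ℂ)) = 0 := by
  simp [besovNorm, distLpNorm_zero, seqNorm_zero hq]

theorem besovNorm_add_le {α : ℝ} {q : ℝ≥0∞} (hq : 1 ≤ q) (u v : 𝓢'(Rd d, ℂ)) :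
    besovNorm α p q (u + v) ≤ besovNorm α p q u + besovNorm α p q v := by
  unfold besovNorm
  refine le_trans (seqNorm_mono fun j => ?_) (seqNorm_add_le hq _ _)
  rw [map_add, ← mul_add]
  exact mul_le_mul_right (distLpNorm_add_le _ _) _

/-- A continuous representative determines the distributional norm: any competitor in `L^p` agrees
with it almost everywhere, by testing against smooth compactly supported functions. When `F` is not
in `L^p` both sides are infinite. -/
theorem distLpNorm_eq_eLpNorm {u : 𝓢'(Rd d, ℂ)} {F : Rd d → ℂ} (hF : Continuous F)
    (h : ∀ φ : 𝓢(Rd d, ℂ), u φ = ∫ x, φ x * F x) : distLpNorm p u = eLpNorm F p volume := by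
  refine le_antisymm ?_ (le_iInf₂ fun k hk => ?_)
  · rcases eq_or_ne (eLpNorm F p volume) ∞ with hT | hT
    · rw [hT]; exact le_top
    have hm : MemLp F p volume := ⟨hF.aestronglyMeasurable, hT.lt_top⟩
    refine (iInf₂_le (hm.toLp F) ?_).trans_eq (Lp.enorm_toLp hm)
    ext φ
    rw [Lp.toTemperedDistribution_apply, h]
    refine integral_congr_ae ?_
    filter_upwards [hm.coeFn_toLp] with x hx
    rw [hx, smul_eq_mul]
  · have : F =ᵐ[volume] k := by
      refine ae_eq_of_integral_contDiff_smul_eq hF.locallyIntegrable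
        ((Lp.memLp k).locallyIntegrable Fact.out) fun g hg hgc => ?_
      have hg₁ : HasCompactSupport (Complex.ofRealCLM ∘ g) := hgc.comp_left rfl
      have hg₂ : ContDiff ℝ (⊤ : ℕ∞) (Complex.ofRealCLM ∘ g) := by fun_prop
      have e1 := h (hg₁.toSchwartzMap hg₂)
      rw [← hk, Lp.toTemperedDistribution_apply] at e1
      simpa using e1.symm
    rw [eLpNorm_congr_ae this, Lp.enorm_def]

end Norms

/-! ### Distributions whose blocks are band-limited functions -/

/-- The `j`-th block of `u` is given by the band-limited function `F`. -/
structure HasField (d j : ℕ) (u : 𝓢'(Rd d, ℂ)) (F : Rd d → ℂ) : Prop where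
  isBand : IsBand d j F
  block_apply : ∀ φ : 𝓢(Rd d, ℂ), block d j u φ = ∫ x, φ x * F x

namespace HasField

variable {d j : ℕ} {u v : 𝓢'(Rd d, ℂ)} {F G : Rd d → ℂ}

theorem integrable_mul (hu : HasField d j u F) (φ : 𝓢(Rd d, ℂ)) :
    Integrable fun x => φ x * F x := by
  obtain ⟨M, hM⟩ := hu.isBand.bounded
  exact φ.integrable.mul_bdd (c := M) hu.isBand.continuous.aestronglyMeasurable
    (Eventually.of_forall hM)

theorem zero : HasField d j 0 (fun _ => 0) where
  isBand := ⟨continuous_const, ⟨0, by simp⟩, by simp⟩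
  block_apply := by simp

theorem sub (hu : HasField d j u F) (hv : HasField d j v G) :
    HasField d j (u - v) fun x => F x - G x where
  isBand := hu.isBand.sub hv.isBand
  block_apply φ := by
    rw [map_sub]
    simp_rw [mul_sub]
    rw [integral_sub (hu.integrable_mul φ) (hv.integrable_mul φ), ← hu.block_apply,
      ← hv.block_apply]
    rfl

theorem add (hu : HasField d j u F) (hv : HasField d j v G) :
    HasField d j (u + v) fun x => F x + G x := by
  simpa using hu.sub (zero.sub hv)

theorem sum {ι : Type*} {s : Finset ι} {U : ι → 𝓢'(Rd d, ℂ)} {H : ι → Rd d → ℂ}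
    (h : ∀ i ∈ s, HasField d j (U i) (H i)) :
    HasField d j (∑ i ∈ s, U i) fun x => ∑ i ∈ s, H i x := by
  classical
  induction s using Finset.induction_on with
  | empty => simpa using zero
  | insert i s hi ih =>
    simp_rw [Finset.sum_insert hi]
    exact (h i (Finset.mem_insert_self _ _)).add
      (ih fun k hk => h k (Finset.mem_insert_of_mem hk))

theorem distLpNorm_eq {p : ℝ≥0∞} [Fact (1 ≤ p)] (hu : HasField d j u F) :
    distLpNorm p (block d j u) = eLpNorm F p volume :=
  distLpNorm_eq_eLpNorm hu.isBand.continuous hu.block_apply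

end HasField

/-- The Besov norm in terms of the Littlewood--Paley pieces. -/
noncomputable def fieldNorm {d : ℕ} (α : ℝ) (p q : ℝ≥0∞) (F : ℕ → Rd d → ℂ) : ℝ≥0∞ :=
  seqNorm q fun j => (2 : ℝ≥0∞) ^ ((j : ℝ) * α) * eLpNorm (F j) p volume

theorem besovNorm_eq_fieldNorm {d : ℕ} {α : ℝ} {p q : ℝ≥0∞} [Fact (1 ≤ p)] {u : 𝓢'(Rd d, ℂ)}
    {F : ℕ → Rd d → ℂ} (h : ∀ j, HasField d j u (F j)) :
    besovNorm α p q u = fieldNorm α p q F := by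
  unfold besovNorm fieldNorm
  simp_rw [(h _).distLpNorm_eq]

theorem fieldNorm_mono {d : ℕ} {α β : ℝ} (hαβ : β ≤ α) {p q : ℝ≥0∞} (F : ℕ → Rd d → ℂ) :
    fieldNorm β p q F ≤ fieldNorm α p q F := by
  refine seqNorm_mono fun j => ?_
  gcongr
  exact one_le_two

theorem eLpNorm_translate {d : ℕ} {p : ℝ≥0∞} {F : Rd d → ℂ} (hF : Continuous F) (h : Rd d) :
    eLpNorm (fun x => F (x - h)) p volume = eLpNorm F p volume :=
  eLpNorm_comp_measurePreserving hF.aestronglyMeasurable (measurePreserving_sub_right volume h)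

theorem fieldNorm_translate {d : ℕ} {α : ℝ} {p q : ℝ≥0∞} {F : ℕ → Rd d → ℂ}
    (hF : ∀ j, IsBand d j (F j)) (h : Rd d) :
    fieldNorm α p q (fun j x => F j (x - h)) = fieldNorm α p q F := by
  unfold fieldNorm
  simp_rw [eLpNorm_translate (hF _).continuous]

theorem exists_fieldNorm_translate_le (d : ℕ) {p q : ℝ≥0∞} (hp : 1 < p) (hp' : p < ∞)
    (hq : 1 ≤ q) :
    ∃ C : ℝ≥0, ∀ γ : ℝ, 0 ≤ γ → γ ≤ 1 → ∀ (α : ℝ) (F : ℕ → Rd d → ℂ),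
      (∀ j, IsBand d j (F j)) → ∀ x y : Rd d,
      fieldNorm (α - γ) p q (fun j z => F j (z - x) - F j (z - y)) ≤
        C * ‖x - y‖ₑ ^ γ * fieldNorm α p q F := by
  obtain ⟨C, hC⟩ := exists_band_translate_le d hp hp'
  refine ⟨C, fun γ hγ hγ1 α F hF x y => ?_⟩
  unfold fieldNorm
  rw [← seqNorm_const_mul hq]
  refine seqNorm_mono fun j => ?_
  -- The difference of two translates is one translation by `x - y` of a function already translated
  -- by `y`.
  have h1 := hC γ hγ hγ1 j _ ((hF j).translate y) (x - y)
  rw [eLpNorm_translate (hF j).continuous] at h1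
  have h2 : ∀ z, z - (x - y) - y = z - x := fun z => by abel
  simp only [h2] at h1
  calc _ ≤ (2 : ℝ≥0∞) ^ ((j : ℝ) * (α - γ)) *
        (C * ((2 : ℝ≥0∞) ^ ((j : ℝ) * γ) * ‖x - y‖ₑ ^ γ) * eLpNorm (F j) p volume) := by gcongr
    _ = C * ‖x - y‖ₑ ^ γ * (((2 : ℝ≥0∞) ^ ((j : ℝ) * (α - γ)) * (2 : ℝ≥0∞) ^ ((j : ℝ) * γ)) *
        eLpNorm (F j) p volume) := by ring
    _ = _ := by
      rw [← ENNReal.rpow_add _ _ (by simp) (by simp)]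
      congr 4
      ring

/-- Lower semicontinuity of the Besov norm: Fatou is used twice, in `L^p` for each block and then in
`ℓ^q`. -/
theorem besovNorm_le_of_tendsto {d : ℕ} {α : ℝ} {p q M : ℝ≥0∞} [Fact (1 ≤ p)] (hq : 1 ≤ q)
    {U : ℕ → 𝓢'(Rd d, ℂ)} {u : 𝓢'(Rd d, ℂ)} {H : ℕ → ℕ → Rd d → ℂ} {F : ℕ → Rd d → ℂ}
    (hU : ∀ n j, HasField d j (U n) (H n j)) (hu : ∀ j, HasField d j u (F j))
    (hlim : ∀ j x, Tendsto (fun n => H n j x) atTop (𝓝 (F j x)))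
    (hM : ∀ n, besovNorm α p q (U n) ≤ M) : besovNorm α p q u ≤ M := by
  simp_rw [besovNorm_eq_fieldNorm (hU _)] at hM
  rw [besovNorm_eq_fieldNorm hu]
  refine seqNorm_le_of_le_liminf hq (fun j => ?_) hM
  have h1 : eLpNorm (F j) p volume ≤ liminf (fun n => eLpNorm (H n j) p volume) atTop :=
    Lp.eLpNorm_lim_le_liminf_eLpNorm
      (fun n => (hU n j).isBand.continuous.aestronglyMeasurable) _
      (Eventually.of_forall fun x => hlim j x)
  refine (mul_le_mul_right h1 _).trans_eq ?_
  refine (ENNReal.liminf_const_mul_of_ne_top ?_).symm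
  exact ENNReal.rpow_ne_top_of_ne_zero (by simp) (by simp)

/-! ### Blocks of finite measures -/

/-- The `j`-th Littlewood--Paley block of a finite measure, as a function. -/
noncomputable def blockField {d : ℕ} (j : ℕ) (ν : Measure (Rd d)) (x : Rd d) : ℂ :=
  ∫ y, blockKernel d j (x - y) ∂ν

theorem blockKernel_norm_le (d j : ℕ) (x : Rd d) :
    ‖blockKernel d j x‖ ≤ SchwartzMap.seminorm ℝ 0 0 (blockKernel d j) :=
  SchwartzMap.norm_le_seminorm ℝ _ x

theorem isBand_blockField {d : ℕ} (j : ℕ) (ν : Measure (Rd d)) [IsFiniteMeasure ν] :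
    IsBand d j (blockField j ν) where
  continuous := by
    refine continuous_of_dominated (bound := fun _ => SchwartzMap.seminorm ℝ 0 0 (blockKernel d j))
      (fun x => ?_) (fun x => Eventually.of_forall fun y => blockKernel_norm_le d j _)
      (integrable_const _) (Eventually.of_forall fun y => ?_)
    · exact ((blockKernel d j).continuous.comp
        (continuous_const.sub continuous_id)).aestronglyMeasurable
    · exact (blockKernel d j).continuous.comp (continuous_id.sub continuous_const)
  bounded := ⟨_, fun x => norm_integral_le_of_norm_le_const
    (Eventually.of_forall fun y => blockKernel_norm_le d j _)⟩
  reproducing x := by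
    have hint : Integrable (Function.uncurry fun (z y : Rd d) =>
        bandKernel d j z * blockKernel d j (x - z - y)) (volume.prod ν) := by
      refine Integrable.mul_bdd (c := SchwartzMap.seminorm ℝ 0 0 (blockKernel d j))
        (f := fun q : Rd d × Rd d => bandKernel d j q.1) ?_ ?_ ?_
      · simpa using (bandKernel d j).integrable.comp_fst ν
      · exact ((blockKernel d j).continuous.comp ((continuous_const.sub continuous_fst).sub
          continuous_snd)).aestronglyMeasurable
      · exact Eventually.of_forall fun q => blockKernel_norm_le d j _
    have := integral_integral_swap hint
    unfold blockField
    simp_rw [← integral_const_mul]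
    rw [this]
    refine integral_congr_ae (Eventually.of_forall fun y => ?_)
    simp only
    rw [blockKernel_reproducing]
    simp_rw [sub_right_comm]

/-- Computes the block of a Dirac mass at `y`, tested against `φ`; integration in `y` then gives the
block of any finite measure. -/
theorem fourier_smulLeft_fourierInv (d j : ℕ) (φ : 𝓢(Rd d, ℂ)) (y : Rd d) :
    (𝓕 (SchwartzMap.smulLeftCLM ℂ (fun ξ : Rd d => (dyadic d j ξ : ℂ)) (𝓕⁻ φ)) : 𝓢(Rd d, ℂ)) y =
      ∫ x, φ x * blockKernel d j (x - y) := by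
  have hL : Continuous fun q : Rd d × Rd d => (-innerₗ (Rd d)) q.1 q.2 := by
    simp only [LinearMap.neg_apply, innerₗ_apply_apply]
    fun_prop
  have hL' : Continuous fun q : Rd d × Rd d => (-innerₗ (Rd d)).flip q.1 q.2 :=
    hL.comp continuous_swap
  have hgi : Integrable fun ξ : Rd d =>
      Real.fourierChar (-inner ℝ ξ y) • dyadicSchwartz d j ξ := by
    refine (dyadicSchwartz d j).integrable.norm.mono' ?_ (Eventually.of_forall fun ξ => by simp)
    exact ((Real.continuous_fourierChar.comp (by fun_prop)).smul
      (dyadicSchwartz d j).continuous).aestronglyMeasurable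
  -- With the pairing `-inner` both transforms below are inverse Fourier transforms, so
  -- self-adjointness moves one from `φ` to the dyadic function. The character in `y` becomes the
  -- shift of the kernel.
  have := VectorFourier.integral_fourierIntegral_smul_eq_flip (μ := volume) (ν := volume)
    (L := -innerₗ (Rd d)) Real.continuous_fourierChar hL φ.integrable hgi
  rw [SchwartzMap.fourier_coe, Real.fourier_eq]
  simp only [SchwartzMap.smulLeftCLM_apply (dyadic_hasTemperateGrowth d j)]
  have e1 : ∀ ξ, VectorFourier.fourierIntegral Real.fourierChar volume (-innerₗ (Rd d)) φ ξ =
      (𝓕⁻ φ : 𝓢(Rd d, ℂ)) ξ := fun ξ => by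
    rw [SchwartzMap.fourierInv_coe, Real.fourierInv_eq]
    simp [VectorFourier.fourierIntegral]
  have e2 : ∀ x, VectorFourier.fourierIntegral Real.fourierChar volume (-innerₗ (Rd d)).flip
      (fun ξ : Rd d => Real.fourierChar (-inner ℝ ξ y) • dyadicSchwartz d j ξ) x =
      blockKernel d j (x - y) := fun x => by
    rw [blockKernel, SchwartzMap.fourierInv_coe, Real.fourierInv_eq]
    refine integral_congr_ae (Eventually.of_forall fun ξ => ?_)
    simp only [LinearMap.flip_apply, LinearMap.neg_apply, innerₗ_apply_apply, neg_neg]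
    rw [smul_smul, ← AddChar.map_add_eq_mul, real_inner_comm, inner_sub_right, sub_eq_add_neg]
  simp_rw [e1, e2] at this
  simp only [smul_eq_mul] at this
  rw [← this]
  refine integral_congr_ae (Eventually.of_forall fun ξ => ?_)
  simp only [dyadicSchwartz_apply, smul_eq_mul, Circle.smul_def]
  ring

theorem hasField_measure {d : ℕ} (j : ℕ) (ν : Measure (Rd d)) [IsFiniteMeasure ν] :
    HasField d j ν.toTemperedDistribution (blockField j ν) where
  isBand := isBand_blockField j ν
  block_apply φ := by
    have hint : Integrable (Function.uncurry fun (y x : Rd d) =>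
        φ x * blockKernel d j (x - y)) (ν.prod volume) := by
      refine Integrable.mul_bdd (c := SchwartzMap.seminorm ℝ 0 0 (blockKernel d j))
        (f := fun q : Rd d × Rd d => φ q.2) ?_ ?_ ?_
      · simpa using φ.integrable.comp_snd ν
      · exact ((blockKernel d j).continuous.comp (continuous_snd.sub
          continuous_fst)).aestronglyMeasurable
      · exact Eventually.of_forall fun q => blockKernel_norm_le d j _
    rw [block, TemperedDistribution.fourierMultiplierCLM_apply_apply]
    refine (Measure.toTemperedDistribution_apply ν _).trans ?_
    simp_rw [fourier_smulLeft_fourierInv]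
    rw [integral_integral_swap hint]
    simp_rw [integral_const_mul]
    rfl

/-! ### Paths of finite variation -/

section Paths

variable {d : ℕ} {r a b : ℝ} {f : ℝ → Rd d}

theorem le_varControl_rpow {F : Type*} [Sub F] (N : F → ℝ≥0∞) {r : ℝ} (hr : 0 < r) (u : ℝ → F)
    {s t : ℝ} (h : s ≤ t) : N (u t - u s) ≤ varControl N r u s t ^ (1 / r) := by
  have := ENNReal.rpow_le_rpow (le_varControl N r u h) (one_div_nonneg.2 hr.le)
  rwa [← ENNReal.rpow_mul, mul_one_div_cancel hr.ne', ENNReal.rpow_one] at this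

/-- The variation on `[a, t]` is a finite monotone function of `t` that dominates the increments of
`f`. So `f` is continuous wherever this function is, that is, off a countable set. -/
theorem exists_countable_continuousWithinAt (hr : 0 < r)
    (hf : varControl (fun x : Rd d => ‖x‖ₑ) r f a b ≠ ∞) :
    ∃ D : Set ℝ, D.Countable ∧ ∀ t ∈ Icc a b \ D, ContinuousWithinAt f (Icc a b) t := by
  set w : ℝ → ℝ := fun t => (varControl (fun x : Rd d => ‖x‖ₑ) r f a t).toReal with hw
  have hfin : ∀ t ∈ Icc a b, varControl (fun x : Rd d => ‖x‖ₑ) r f a t ≠ ∞ := fun t ht =>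
    ne_top_of_le_ne_top hf (varControl_mono _ _ _ le_rfl ht.2)
  have hmono : MonotoneOn w (Icc a b) := fun s hs t ht hst =>
    ENNReal.toReal_mono (hfin t ht) (varControl_mono _ _ _ le_rfl hst)
  have hle : ∀ s ∈ Icc a b, ∀ t ∈ Icc a b, s ≤ t → ‖f t - f s‖ ^ r ≤ w t - w s := by
    intro s hs t ht hst
    have h1 := (add_le_add_right (le_varControl (fun x : Rd d => ‖x‖ₑ) r f hst)
      (varControl (fun x : Rd d => ‖x‖ₑ) r f a s)).trans (varControl_add_le _ _ _ hs.1 hst)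
    have h2 := ENNReal.toReal_mono (hfin t ht) h1
    rw [ENNReal.toReal_add (hfin s hs) (ENNReal.rpow_ne_top_of_nonneg hr.le (by simp)),
      ← ENNReal.toReal_rpow, toReal_enorm] at h2
    simp only [hw]
    linarith
  have hle' : ∀ s ∈ Icc a b, ∀ t ∈ Icc a b, ‖f t - f s‖ ≤ |w t - w s| ^ (1 / r) := by
    intro s hs t ht
    have h3 : ‖f t - f s‖ ^ r ≤ |w t - w s| := by
      rcases le_total s t with h | h
      · exact (hle s hs t ht h).trans (le_abs_self _)
      · rw [norm_sub_rev, abs_sub_comm]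
        exact (hle t ht s hs h).trans (le_abs_self _)
    have := Real.rpow_le_rpow (by positivity) h3 (one_div_nonneg.2 hr.le)
    rwa [← Real.rpow_mul (norm_nonneg _), mul_one_div_cancel hr.ne', Real.rpow_one] at this
  refine ⟨_, hmono.countable_not_continuousWithinAt, fun t ht => ?_⟩
  have hct : ContinuousWithinAt w (Icc a b) t := by
    by_contra h
    exact ht.2 ⟨ht.1, h⟩
  rw [ContinuousWithinAt, tendsto_iff_norm_sub_tendsto_zero]
  have hz : Tendsto (fun x => |w x - w t| ^ (1 / r)) (𝓝[Icc a b] t) (𝓝 0) := by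
    have h1 : Tendsto (fun x => |w x - w t|) (𝓝[Icc a b] t) (𝓝 0) := by
      simpa using (hct.tendsto.sub_const (w t)).abs
    simpa [hr.ne'] using h1.rpow_const (p := 1 / r) (Or.inr (by positivity))
  refine squeeze_zero' (Eventually.of_forall fun _ => norm_nonneg _) ?_ hz
  filter_upwards [self_mem_nhdsWithin] with x hx
  exact hle' t ht.1 x hx

theorem aemeasurable_of_varControl_ne_top (hr : 0 < r)
    (hf : varControl (fun x : Rd d => ‖x‖ₑ) r f a b ≠ ∞) :
    AEMeasurable f (volume.restrict (Icc a b)) := by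
  obtain ⟨D, hD, hc⟩ := exists_countable_continuousWithinAt hr hf
  have hc' : ContinuousOn f (Icc a b \ D) := fun t ht => (hc t ht).mono sdiff_subset
  have h1 := hc'.aemeasurable (μ := volume) (measurableSet_Icc.diff hD.measurableSet)
  rwa [Measure.restrict_congr_set (sdiff_null_ae_eq_self (hD.measure_zero volume))] at h1

end Paths

/-! ### Occupation measures -/

section Occ

variable {d : ℕ} {ω : ℝ → Rd d} {s t : ℝ}

theorem blockField_occMeasure (hω : AEMeasurable ω (volume.restrict (Ioc s t))) (j : ℕ) (x : Rd d) :
    blockField j (occMeasure ω s t) x = ∫ τ in Ioc s t, blockKernel d j (x - ω τ) := by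
  unfold blockField occMeasure
  rw [integral_map hω]
  exact ((blockKernel d j).continuous.comp
    (continuous_const.sub continuous_id)).aestronglyMeasurable

theorem blockField_occMeasure_add (hω : AEMeasurable ω (volume.restrict (Ioc s t))) (j : ℕ)
    (c x : Rd d) : blockField j (occMeasure (fun τ => ω τ + c) s t) x =
      blockField j (occMeasure ω s t) (x - c) := by
  rw [blockField_occMeasure hω, blockField_occMeasure (hω.add_const c)]
  refine integral_congr_ae (Eventually.of_forall fun τ => ?_)
  simp only
  congr 1
  abel

theorem hasField_occ_add (hω : AEMeasurable ω (volume.restrict (Ioc s t))) (j : ℕ) (c : Rd d) :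
    HasField d j (occ (fun τ => ω τ + c) s t)
      (fun x => blockField j (occMeasure ω s t) (x - c)) := by
  have := hasField_measure j (occMeasure (fun τ => ω τ + c) s t)
  rwa [funext (blockField_occMeasure_add hω j c)] at this

theorem hasField_occ (j : ℕ) (ω : ℝ → Rd d) (s t : ℝ) :
    HasField d j (occ ω s t) (blockField j (occMeasure ω s t)) :=
  hasField_measure j _

theorem occ_apply (hω : AEMeasurable ω (volume.restrict (Ioc s t))) (φ : 𝓢(Rd d, ℂ)) :
    occ ω s t φ = ∫ τ in Ioc s t, φ (ω τ) := by
  refine (Measure.toTemperedDistribution_apply _ _).trans ?_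
  exact integral_map hω φ.continuous.aestronglyMeasurable

theorem occ_self (ω : ℝ → Rd d) (s : ℝ) : occ ω s s = 0 := by
  have hω : AEMeasurable ω (volume.restrict (Ioc s s)) := by simp
  ext φ
  rw [occ_apply hω]
  simp

theorem occ_add_occ {m : ℝ} (hsm : s ≤ m) (hmt : m ≤ t)
    (hω : AEMeasurable ω (volume.restrict (Ioc s t))) :
    occ ω s m + occ ω m t = occ ω s t := by
  have h1 : AEMeasurable ω (volume.restrict (Ioc s m)) :=
    hω.mono_set (Ioc_subset_Ioc le_rfl hmt)
  have h2 : AEMeasurable ω (volume.restrict (Ioc m t)) :=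
    hω.mono_set (Ioc_subset_Ioc hsm le_rfl)
  ext φ
  have hi : ∀ u v, AEMeasurable ω (volume.restrict (Ioc u v)) →
      IntegrableOn (fun τ => φ (ω τ)) (Ioc u v) := fun u v huv => by
    refine Integrable.of_bound (C := SchwartzMap.seminorm ℝ 0 0 φ) ?_
      (Eventually.of_forall fun τ => SchwartzMap.norm_le_seminorm ℝ φ _)
    exact (φ.continuous.measurable.comp_aemeasurable huv).aestronglyMeasurable
  change occ ω s m φ + occ ω m t φ = occ ω s t φ
  rw [occ_apply h1, occ_apply h2, occ_apply hω, ← Ioc_union_Ioc_eq_Ioc hsm hmt,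
    setIntegral_union (Ioc_disjoint_Ioc_of_le le_rfl) measurableSet_Ioc (hi _ _ h1) (hi _ _ h2)]

end Occ

/-! ### Riemann sums -/

theorem exists_partitions {a b s t : ℝ} (has : a ≤ s) (hst : s < t) (htb : t ≤ b) {S : Set ℝ}
    (hS : ∀ᵐ τ ∂volume.restrict (Icc a b), τ ∈ S) :
    ∃ π : ℕ → ℕ → ℝ, (∀ n, Monotone (π n)) ∧ (∀ n i, π n i ∈ S ∩ Ioo s t) ∧
      ∀ τ ∈ Ioo s t, ∀ ε > 0, ∀ᶠ n in atTop, ∃ i < n, τ ∈ Ioc (π n i) (π n (i + 1)) ∧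
        |π n i - τ| < ε := by
  have hpick : ∀ u v : ℝ, s ≤ u → u < v → v ≤ t → ∃ x, x ∈ S ∧ x ∈ Ioo u v := by
    intro u v hu huv hv
    by_contra! h
    rw [ae_restrict_iff' measurableSet_Icc, ae_iff] at hS
    have : Ioo u v ⊆ {x | ¬(x ∈ Icc a b → x ∈ S)} := fun x hx => by
      simp only [mem_ofPred_eq, Classical.not_imp]
      exact ⟨⟨by linarith [hx.1], by linarith [hx.2]⟩, fun hxS => h x hxS hx⟩
    have h0 := measure_mono_null this hS
    rw [Real.volume_Ioo, ENNReal.ofReal_eq_zero] at h0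
    linarith
  -- The interval is cut into `n + 1` equal cells, with one point of `S` chosen in each. Taking `min
  -- i n` freezes the sequence after its last point.
  set δ : ℕ → ℝ := fun n => (t - s) / (n + 1) with hδ
  have hδ0 : ∀ n, 0 < δ n := fun n => div_pos (by linarith) (by positivity)
  have hδn : ∀ n, (n + 1) * δ n = t - s := fun n => by simp only [hδ]; field_simp
  have hcell : ∀ n i : ℕ, ∃ x, x ∈ S ∧
      x ∈ Ioo (s + (min i n : ℕ) * δ n) (s + ((min i n : ℕ) + 1) * δ n) := fun n i => by
    have h1 : ((min i n : ℕ) : ℝ) ≤ n := by exact_mod_cast min_le_right i n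
    refine hpick _ _ ?_ ?_ ?_
    · have := hδ0 n; nlinarith [Nat.cast_nonneg (α := ℝ) (min i n)]
    · have := hδ0 n; nlinarith
    · have := hδ0 n; nlinarith [hδn n]
  choose x hxS hx using hcell
  set π : ℕ → ℕ → ℝ := fun n i => x n (min i n) with hπ
  have hπI : ∀ n i, π n i ∈ Ioo (s + (min i n : ℕ) * δ n) (s + ((min i n : ℕ) + 1) * δ n) :=
    fun n i => by simpa using hx n (min i n)
  have hmono : ∀ n, Monotone (π n) := fun n => by
    refine monotone_nat_of_le_succ fun i => ?_
    rcases Nat.lt_or_ge i n with h | h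
    · have h1 := (hπI n i).2
      have h2 := (hπI n (i + 1)).1
      rw [min_eq_left h.le] at h1
      rw [min_eq_left h] at h2
      push_cast at h2
      linarith
    · simp only [hπ, min_eq_right h, min_eq_right (h.trans (Nat.le_succ i))]
      exact le_rfl
  have hπs : ∀ n i, π n i ∈ Ioo s t := fun n i => by
    have h1 : ((min i n : ℕ) : ℝ) ≤ n := by exact_mod_cast min_le_right i n
    have h2 := hπI n i
    have h3 := hδ0 n
    exact ⟨by nlinarith [h2.1, Nat.cast_nonneg (α := ℝ) (min i n)], by nlinarith [h2.2, hδn n]⟩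
  refine ⟨π, hmono, fun n i => ⟨hxS _ _, hπs n i⟩, fun τ hτ ε hε => ?_⟩
  have hlim : Tendsto δ atTop (𝓝 0) := by
    simpa [hδ, div_eq_mul_inv] using
      (tendsto_one_div_add_atTop_nhds_zero_nat (𝕜 := ℝ)).const_mul (t - s)
  -- The first two bounds put `τ` between the first and the last partition point. The third makes
  -- neighbouring points, less than `2 * δ n` apart, `ε`-close.
  filter_upwards [hlim.eventually_lt_const (sub_pos.2 hτ.1),
    hlim.eventually_lt_const (sub_pos.2 hτ.2), hlim.eventually_lt_const (half_pos hε)]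
    with n h1 h2 h3
  have hlast : τ ≤ π n n := by
    have := (hπI n n).1
    rw [min_self] at this
    nlinarith [hδn n]
  have hfirst : π n 0 < τ := by
    have := (hπI n 0).2
    simp at this
    linarith
  classical
  have hex : ∃ k, τ ≤ π n k := ⟨n, hlast⟩
  set k := Nat.find hex with hk
  have hk0 : k ≠ 0 := fun h0 => by
    have := Nat.find_spec hex
    rw [← hk, h0] at this
    linarith
  have hkn : k ≤ n := Nat.find_min' hex hlast
  have hkτ : τ ≤ π n k := Nat.find_spec hex
  have hk1 : π n (k - 1) < τ := not_le.1 (Nat.find_min hex (by omega))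
  refine ⟨k - 1, by omega, ⟨hk1, by rwa [Nat.sub_add_cancel (by omega)]⟩, ?_⟩
  rw [abs_sub_lt_iff]
  refine ⟨by linarith, ?_⟩
  have h4 := (hπI n (k - 1)).1
  have h5 := (hπI n k).2
  rw [min_eq_left hkn] at h5
  rw [min_eq_left (by omega), Nat.cast_sub (by omega)] at h4
  push_cast at h4
  nlinarith [hδ0 n]

theorem sum_indicator_Ioc {E : Type*} [AddCommMonoid E] {π : ℕ → ℝ} (hπ : Monotone π) {n i : ℕ}
    (hi : i < n) {τ : ℝ} (hτ : τ ∈ Ioc (π i) (π (i + 1))) (g : ℕ → ℝ → E) :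
    ∑ k ∈ Finset.range n, (Ioc (π k) (π (k + 1))).indicator (g k) τ = g i τ := by
  rw [Finset.sum_eq_single i, indicator_of_mem hτ]
  · intro k _ hki
    refine indicator_of_notMem (fun hk => ?_) _
    rcases lt_or_gt_of_ne hki with h | h
    · exact absurd (hk.2.trans (hπ h)) (not_le.2 hτ.1)
    · exact absurd (hτ.2.trans (hπ h)) (not_le.2 hk.1)
  · exact fun h => absurd (Finset.mem_range.2 hi) h

theorem tendsto_riemann_blockField {d : ℕ} {r a b s t : ℝ} (hr : 0 < r) (has : a ≤ s)
    (htb : t ≤ b) {ω f : ℝ → Rd d} (hω : AEMeasurable ω (volume.restrict (Icc a b)))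
    (hf : varControl (fun x : Rd d => ‖x‖ₑ) r f a b ≠ ∞) {π : ℕ → ℕ → ℝ}
    (hmono : ∀ n, Monotone (π n)) (hmem : ∀ n i, π n i ∈ Ioo s t)
    (hπ : ∀ τ ∈ Ioo s t, ∀ ε > 0, ∀ᶠ n in atTop, ∃ i < n, τ ∈ Ioc (π n i) (π n (i + 1)) ∧
        |π n i - τ| < ε) (j : ℕ) (x : Rd d) :
    Tendsto (fun n => ∑ i ∈ Finset.range n, blockField j
        (occMeasure (fun τ => ω τ + f (π n i)) (π n i) (π n (i + 1))) x) atTop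
      (𝓝 (blockField j (occMeasure (fun τ => ω τ + f τ) s t) x)) := by
  have hIst : Ioc s t ⊆ Icc a b := Ioc_subset_Icc_self.trans (Icc_subset_Icc has htb)
  have hfm := aemeasurable_of_varControl_ne_top hr hf
  have hωst := hω.mono_set hIst
  have hIπ : ∀ n i, Ioc (π n i) (π n (i + 1)) ⊆ Ioc s t := fun n i =>
    Ioc_subset_Ioc (hmem n i).1.le (hmem n _).2.le
  have hωf : AEMeasurable (fun τ => ω τ + f τ) (volume.restrict (Ioc s t)) :=
    (hω.add hfm).mono_set hIst
  rw [blockField_occMeasure hωf]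
  have hmeas : ∀ c : Rd d, AEStronglyMeasurable (fun τ => blockKernel d j (x - (ω τ + c)))
      (volume.restrict (Ioc s t)) := fun c =>
    ((blockKernel d j).continuous.measurable.comp_aemeasurable
      ((hωst.add_const c).const_sub x)).aestronglyMeasurable
  have hint : ∀ c : Rd d, IntegrableOn (fun τ => blockKernel d j (x - (ω τ + c))) (Ioc s t) :=
    fun c => Integrable.of_bound (hmeas c) _
      (Eventually.of_forall fun τ => blockKernel_norm_le d j _)
  set g : ℕ → ℕ → ℝ → ℂ := fun n i τ => blockKernel d j (x - (ω τ + f (π n i))) with hg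
  have hsum : ∀ n, ∑ i ∈ Finset.range n, blockField j
        (occMeasure (fun τ => ω τ + f (π n i)) (π n i) (π n (i + 1))) x =
      ∫ τ in Ioc s t, ∑ i ∈ Finset.range n,
        (Ioc (π n i) (π n (i + 1))).indicator (g n i) τ := fun n => by
    rw [integral_finsetSum]
    · refine Finset.sum_congr rfl fun i _ => ?_
      rw [blockField_occMeasure ((hωst.mono_set (hIπ n i)).add_const _),
        integral_indicator measurableSet_Ioc, Measure.restrict_restrict measurableSet_Ioc,
        inter_eq_left.2 (hIπ n i)]
    · exact fun i _ => (hint _).indicator measurableSet_Ioc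
  simp_rw [hsum]
  refine tendsto_integral_of_dominated_convergence
    (fun _ => SchwartzMap.seminorm ℝ 0 0 (blockKernel d j)) (fun n => ?_) (integrable_const _)
    (fun n => Eventually.of_forall fun τ => ?_) ?_
  · exact Finset.aestronglyMeasurable_fun_sum _ fun i _ => (hmeas _).indicator measurableSet_Ioc
  · by_cases h : ∃ i < n, τ ∈ Ioc (π n i) (π n (i + 1))
    · obtain ⟨i, hi, hτ⟩ := h
      rw [sum_indicator_Ioc (hmono n) hi hτ]
      exact blockKernel_norm_le d j _
    · push Not at h
      rw [Finset.sum_eq_zero fun i hi => indicator_of_notMem (h i (Finset.mem_range.1 hi)) _]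
      simp
  · obtain ⟨D, hD, hc⟩ := exists_countable_continuousWithinAt hr hf
    -- The endpoint `t` is also excluded, as the partitions exhaust only the open interval.
    have hDt := (hD.insert t).ae_notMem volume
    filter_upwards [ae_restrict_mem measurableSet_Ioc, ae_restrict_of_ae hDt] with τ hτ hτD
    have hτt : τ ≠ t := fun h => hτD (h ▸ mem_insert _ _)
    have hτ' : τ ∈ Ioo s t := ⟨hτ.1, lt_of_le_of_ne hτ.2 hτt⟩
    have hcf := hc τ ⟨hIst hτ, fun h => hτD (mem_insert_of_mem _ h)⟩
    have hcK : ContinuousWithinAt (fun σ => blockKernel d j (x - (ω τ + f σ))) (Icc a b) τ :=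
      (blockKernel d j).continuous.continuousAt.comp_continuousWithinAt
        (continuousWithinAt_const.sub (continuousWithinAt_const.add hcf))
    rw [Metric.tendsto_atTop']
    intro ε hε
    obtain ⟨δ, hδ, hδε⟩ := Metric.continuousWithinAt_iff.1 hcK ε hε
    obtain ⟨N, hN⟩ := eventually_atTop.1 (hπ τ hτ' δ hδ)
    refine ⟨N, fun n hn => ?_⟩
    obtain ⟨i, hi, hτi, hd⟩ := hN n hn.le
    rw [sum_indicator_Ioc (hmono n) hi hτi]
    exact hδε (hIst ⟨(hmem n i).1, (hmem n i).2.le⟩) (by rwa [Real.dist_eq])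

/-! ### Variation of averaged paths -/

theorem rVariation_le_of_increment_le {F G : Type*} [Sub F] [Sub G] {N : F → ℝ≥0∞}
    {N' : G → ℝ≥0∞} {r a b : ℝ} (hr : 0 < r) {X : ℝ → F} {v : ℝ → G} {M : ℝ≥0∞}
    (h : ∀ s t, a ≤ s → s ≤ t → t ≤ b → N (X t - X s) ≤ M * varControl N' r v s t ^ (1 / r)) :
    rVariation N r a b X ≤ M * rVariation N' r a b v := by
  have h1 : varControl N r X a b ≤ M ^ r * varControl N' r v a b := by
    refine iSup_le fun ⟨n, t, ht, htm⟩ => ?_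
    calc ∑ i ∈ Finset.range n, N (X (t (i + 1)) - X (t i)) ^ r
        ≤ ∑ i ∈ Finset.range n, M ^ r * varControl N' r v (t i) (t (i + 1)) := by
          refine Finset.sum_le_sum fun i _ => ?_
          have := ENNReal.rpow_le_rpow
            (h _ _ (htm i).1 (ht (Nat.le_succ i)) (htm (i + 1)).2) hr.le
          rwa [ENNReal.mul_rpow_of_nonneg _ _ hr.le, ← ENNReal.rpow_mul,
            one_div_mul_cancel hr.ne', ENNReal.rpow_one] at this
      _ = M ^ r * ∑ i ∈ Finset.range n, varControl N' r v (t i) (t (i + 1)) :=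
          (Finset.mul_sum _ _ _).symm
      _ ≤ M ^ r * varControl N' r v a b := by
          refine mul_le_mul_right (((isControl_varControl N' r v univ).sum_le ht
            (fun _ => mem_univ _) n).trans (varControl_mono _ _ _ (htm 0).1 (htm n).2)) _
  rw [rVariation_eq, rVariation_eq]
  refine (ENNReal.rpow_le_rpow h1 (by positivity)).trans_eq ?_
  rw [ENNReal.mul_rpow_of_nonneg _ _ (by positivity), ← ENNReal.rpow_mul,
    mul_one_div_cancel hr.ne', ENNReal.rpow_one]

section

variable {d : ℕ} {p q : ℝ≥0∞} [Fact (1 ≤ p)]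

theorem occ_sub_occ {ω : ℝ → Rd d} {a b s t : ℝ} (has : a ≤ s) (hst : s ≤ t) (htb : t ≤ b)
    (hω : AEMeasurable ω (volume.restrict (Icc a b))) :
    occ ω a t - occ ω a s = occ ω s t := by
  rw [← occ_add_occ has hst (hω.mono_set (Ioc_subset_Icc_self.trans (Icc_subset_Icc le_rfl htb)))]
  abel

theorem besovNorm_occ_le {α r : ℝ} (hr : 0 < r) {ω : ℝ → Rd d} {a b s t : ℝ} (has : a ≤ s)
    (hst : s ≤ t) (htb : t ≤ b) (hω : AEMeasurable ω (volume.restrict (Icc a b))) :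
    besovNorm α p q (occ ω s t) ≤
      varControl (besovNorm α p q) r (fun t => occ ω a t) s t ^ (1 / r) := by
  rw [← occ_sub_occ has hst htb hω]
  exact le_varControl_rpow _ hr (fun t => occ ω a t) hst

theorem besovNorm_occ_eq (α : ℝ) (ω : ℝ → Rd d) (s t : ℝ) :
    besovNorm α p q (occ ω s t) = fieldNorm α p q fun j => blockField j (occMeasure ω s t) :=
  besovNorm_eq_fieldNorm fun j => hasField_occ j ω s t

theorem besovNorm_occ_add {α : ℝ} {ω : ℝ → Rd d} {s t : ℝ}
    (hω : AEMeasurable ω (volume.restrict (Ioc s t))) (c : Rd d) :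
    besovNorm α p q (occ (fun τ => ω τ + c) s t) = besovNorm α p q (occ ω s t) := by
  rw [besovNorm_eq_fieldNorm (hasField_occ_add hω · c), besovNorm_occ_eq,
    fieldNorm_translate fun j => isBand_blockField j _]

theorem besovNorm_occ_mono {α β : ℝ} (h : β ≤ α) (ω : ℝ → Rd d) (s t : ℝ) :
    besovNorm β p q (occ ω s t) ≤ besovNorm α p q (occ ω s t) := by
  simp_rw [besovNorm_occ_eq]
  exact fieldNorm_mono h _

variable (d) in
/-- Moving a path by constants: first and second order differences of occupation measures. -/
theorem exists_besovNorm_occ_sub_le (hp : 1 < p) (hp' : p < ∞) (hq : 1 ≤ q) :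
    ∃ C : ℝ≥0, ∀ (γ α s t : ℝ) (ω : ℝ → Rd d), 0 ≤ γ → γ ≤ 1 →
      AEMeasurable ω (volume.restrict (Ioc s t)) →
      (∀ x y : Rd d, besovNorm (α - γ) p q
        (occ (fun τ => ω τ + x) s t - occ (fun τ => ω τ + y) s t) ≤
          C * ‖x - y‖ₑ ^ γ * besovNorm α p q (occ ω s t)) ∧
      ∀ x y x' y' : Rd d, besovNorm (α - γ - 1) p q
        ((occ (fun τ => ω τ + x') s t - occ (fun τ => ω τ + y') s t) -
          (occ (fun τ => ω τ + x) s t - occ (fun τ => ω τ + y) s t)) ≤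
        C * (‖(x' - y') - (x - y)‖ₑ + ‖y' - y‖ₑ ^ γ * ‖x - y‖ₑ) *
          besovNorm α p q (occ ω s t) := by
  obtain ⟨C, hC⟩ := exists_fieldNorm_translate_le d (q := q) hp hp' hq
  refine ⟨max C (C * C), fun γ α s t ω hγ hγ1 hω => ?_⟩
  have hC1 : (C : ℝ≥0∞) ≤ (max C (C * C) : ℝ≥0) := by exact_mod_cast le_max_left _ _
  have hC2 : (C : ℝ≥0∞) * C ≤ (max C (C * C) : ℝ≥0) := by
    exact_mod_cast le_max_right C (C * C)
  set F : ℕ → Rd d → ℂ := fun j => blockField j (occMeasure ω s t) with hF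
  have hFb : ∀ j, IsBand d j (F j) := fun j => isBand_blockField j _
  have hT : ∀ j c, HasField d j (occ (fun τ => ω τ + c) s t) (fun z => F j (z - c)) :=
    fun j c => hasField_occ_add hω j c
  set T : Rd d → 𝓢'(Rd d, ℂ) := fun c => occ (fun τ => ω τ + c) s t with hTdef
  have hone : ∀ γ : ℝ, 0 ≤ γ → γ ≤ 1 → ∀ (α : ℝ) (x y : Rd d), besovNorm (α - γ) p q (T x - T y) ≤
      C * ‖x - y‖ₑ ^ γ * fieldNorm α p q F := fun γ hγ hγ1 α x y => by
    rw [besovNorm_eq_fieldNorm fun j => (hT j x).sub (hT j y)]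
    exact hC γ hγ hγ1 α F hFb x y
  rw [besovNorm_occ_eq]
  refine ⟨fun x y => (hone γ hγ hγ1 α x y).trans ?_, fun x y x' y' => ?_⟩
  · gcongr
  · set h := x - y with hh
    -- In the first term the two shifts differ by `(x' - y') - h`. In the second, the same
    -- difference operator with step `h` is moved from `y` to `y'`, which costs `1 + γ` derivatives.
    have heq : T x' - T y' - (T x - T y) =
        (T x' - T (y' + h)) + ((T (y' + h) - T y') - (T (y + h) - T y)) := by
      rw [hh, add_sub_cancel]; abel
    have e1 : besovNorm (α - γ - 1) p q (T x' - T (y' + h)) ≤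
        C * ‖(x' - y') - h‖ₑ * fieldNorm α p q F := by
      refine (hone 1 zero_le_one le_rfl (α - γ) x' (y' + h)).trans ?_
      rw [ENNReal.rpow_one, sub_add_eq_sub_sub]
      gcongr
      exact fieldNorm_mono (by linarith) F
    have e2 : besovNorm (α - γ - 1) p q ((T (y' + h) - T y') - (T (y + h) - T y)) ≤
        C * C * (‖y' - y‖ₑ ^ γ * ‖h‖ₑ) * fieldNorm α p q F := by
      set V : ℕ → Rd d → ℂ := fun j z => F j (z - h) - F j z with hV
      have hVb : ∀ j, IsBand d j (V j) := fun j => ((hFb j).translate h).sub (hFb j)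
      have hVn : fieldNorm (α - 1) p q V ≤ C * ‖h‖ₑ * fieldNorm α p q F := by
        simpa using hC 1 zero_le_one le_rfl α F hFb h 0
      rw [besovNorm_eq_fieldNorm fun j =>
        ((hT j (y' + h)).sub (hT j y')).sub ((hT j (y + h)).sub (hT j y))]
      have := hC γ hγ hγ1 (α - 1) V hVb y' y
      simp only [hV, fun z c : Rd d => sub_sub z c h] at this
      rw [show α - γ - 1 = α - 1 - γ by ring]
      refine this.trans ?_
      calc _ ≤ (C : ℝ≥0∞) * ‖y' - y‖ₑ ^ γ * (C * ‖h‖ₑ * fieldNorm α p q F) := by gcongr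
        _ = _ := by ring
    rw [heq]
    refine (besovNorm_add_le hq _ _).trans ((add_le_add e1 e2).trans ?_)
    rw [mul_add, add_mul]
    gcongr

theorem sewing_defect {ω : ℝ → Rd d} {s m t : ℝ} (hsm : s ≤ m) (hmt : m ≤ t)
    (hω : AEMeasurable ω (volume.restrict (Ioc s t))) (x y : Rd d) :
    occ (fun τ => ω τ + x) s m + occ (fun τ => ω τ + y) m t - occ (fun τ => ω τ + x) s t =
      occ (fun τ => ω τ + y) m t - occ (fun τ => ω τ + x) m t := by
  rw [← occ_add_occ hsm hmt (hω.add_const x)]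
  abel

variable (d) in
theorem exists_rVariation_occ_add_le (hp : 1 < p) (hp' : p < ∞) (hq : 1 ≤ q) {r r₁ γ : ℝ}
    (hr : 0 < r) (hr₁ : 0 < r₁) (hγ : 0 < γ) (hγ₁ : γ ≤ 1) (hyoung : 1 < γ / r₁ + 1 / r) :
    ∃ C : ℝ≥0, ∀ (α a b : ℝ) (ω f : ℝ → Rd d),
      AEMeasurable ω (volume.restrict (Icc a b)) →
      rVariation (fun x => ‖x‖ₑ) r₁ a b f < ∞ →
      rVariation (besovNorm (α - γ) p q) r a b (fun t => occ (fun s => ω s + f s) a t) ≤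
        (1 + C * rVariation (fun x => ‖x‖ₑ) r₁ a b f ^ γ) *
          rVariation (besovNorm α p q) r a b (fun t => occ ω a t) := by
  obtain ⟨C, hC⟩ := exists_besovNorm_occ_sub_le d (q := q) hp hp' hq
  obtain ⟨K, hK⟩ := exists_young_const (div_pos hγ hr₁) (one_div_pos.2 hr) hyoung
  refine ⟨K * C, fun α a b ω f hω hf => ?_⟩
  set W := varControl (fun x : Rd d => ‖x‖ₑ) r₁ f with hW
  have hWfin : W a b ≠ ∞ := fun h => by
    rw [rVariation_eq, ← hW, h, ENNReal.top_rpow_of_pos (by positivity)] at hf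
    exact lt_irrefl _ hf
  have hsub : ∀ s t, a ≤ s → t ≤ b → AEMeasurable ω (volume.restrict (Ioc s t)) :=
    fun s t hs ht => hω.mono_set (Ioc_subset_Icc_self.trans (Icc_subset_Icc hs ht))
  have hωf : AEMeasurable (fun τ => ω τ + f τ) (volume.restrict (Icc a b)) :=
    hω.add (aemeasurable_of_varControl_ne_top hr₁ hWfin)
  refine rVariation_le_of_increment_le hr fun s t has hst htb => ?_
  rw [occ_sub_occ has hst htb hωf]
  rcases hst.eq_or_lt with rfl | hst'
  · rw [occ_self, besovNorm_zero hq]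
    exact zero_le
  obtain ⟨π, hmono, hmem, hπ⟩ := exists_partitions has hst' htb (S := Icc a b)
    (ae_restrict_mem measurableSet_Icc)
  have hpow : rVariation (fun x : Rd d => ‖x‖ₑ) r₁ a b f ^ γ = W a b ^ (γ / r₁) := by
    rw [rVariation_eq, ← ENNReal.rpow_mul, one_div_mul_eq_div]
  refine besovNorm_le_of_tendsto hq
    (fun n j => HasField.sum fun i _ => hasField_occ j (fun τ => ω τ + f (π n i)) (π n i)
      (π n (i + 1))) (fun j => hasField_occ j _ s t)
    (tendsto_riemann_blockField hr₁ has htb hω hWfin hmono (fun n i => (hmem n i).2) hπ)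
    fun n => ?_
  -- Translation preserves the Besov norm, so the germ itself is bounded with `c = 1`; the constant
  -- from translating enters only through the defect.
  refine (hK (besovNorm_zero hq) (besovNorm_add_le (α := α - γ) hq) (S := Icc a b)
    (isControl_varControl (fun x : Rd d => ‖x‖ₑ) r₁ f _) (isControl_varControl (besovNorm α p q) r
      (fun t => occ ω a t) _) (Ξ := fun u v => occ (fun τ => ω τ + f u) u v) (c := 1) (C := C)
    (fun u _ => occ_self _ u) (fun u hu v hv huv => ?_) (fun u hu m hm v hv hum hmv => ?_) n (π n)
    (hmono n) (fun i => (hmem n i).1)).trans ?_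
  · rw [one_mul, besovNorm_occ_add (hsub u v hu.1 hv.2)]
    exact (besovNorm_occ_mono (by linarith) ω u v).trans (besovNorm_occ_le hr hu.1 huv hv.2 hω)
  · rw [sewing_defect hum hmv (hsub u v hu.1 hv.2)]
    refine ((hC γ α m v ω hγ.le hγ₁ (hsub m v hm.1 hv.2)).1 (f m) (f u)).trans ?_
    gcongr
    · refine (ENNReal.rpow_le_rpow (le_varControl_rpow (fun x : Rd d => ‖x‖ₑ) hr₁ f hum)
        hγ.le).trans_eq ?_
      rw [← ENNReal.rpow_mul, one_div_mul_eq_div]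
    · exact besovNorm_occ_le hr hm.1 hmv hv.2 hω
  · rw [hpow, ENNReal.coe_mul, mul_assoc (K : ℝ≥0∞)]
    gcongr
    · exact varControl_mono _ _ _ (has.trans (hmem n 0).2.1.le) ((hmem n n).2.2.le.trans htb)
    · exact varControl_mono _ _ _ (hmem n 0).2.1.le (hmem n n).2.2.le

variable (d) in
theorem exists_rVariation_occ_sub_le (hp : 1 < p) (hp' : p < ∞) (hq : 1 ≤ q) {r r₁ γ : ℝ}
    (hr : 0 < r) (hr₁ : 1 ≤ r₁) (hγ : 0 < γ) (hγ₁ : γ ≤ 1) (hyoung : 1 < γ / r₁ + 1 / r) :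
    ∃ C : ℝ≥0, ∀ (α a b : ℝ) (ω f g : ℝ → Rd d),
      AEMeasurable ω (volume.restrict (Icc a b)) →
      rVariation (fun x => ‖x‖ₑ) r₁ a b f < ∞ →
      rVariation (fun x => ‖x‖ₑ) r₁ a b g < ∞ →
      rVariation (besovNorm (α - γ - 1) p q) r a b
          (fun t => occ (fun s => ω s + f s) a t - occ (fun s => ω s + g s) a t) ≤
        C * rVariation (besovNorm α p q) r a b (fun t => occ ω a t) *
          (rVariation (fun x => ‖x‖ₑ) r₁ a b (fun s => f s - g s) +
            (1 + rVariation (fun x => ‖x‖ₑ) r₁ a b g) *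
              eLpNorm (fun s => f s - g s) ∞ (volume.restrict (Icc a b))) := by
  obtain ⟨C, hC⟩ := exists_besovNorm_occ_sub_le d (q := q) hp hp' hq
  have hr₁0 : 0 < r₁ := by linarith
  have hx : 0 < γ / r₁ := div_pos hγ hr₁0
  have hx1 : γ / r₁ ≤ 1 := by rw [div_le_one hr₁0]; linarith
  obtain ⟨K, hK⟩ := exists_young_const hx (one_div_pos.2 hr) hyoung
  refine ⟨C + 2 * (K * C), fun α a b ω f g hω hf hg => ?_⟩
  set H := eLpNorm (fun s => f s - g s) ∞ (volume.restrict (Icc a b)) with hH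
  set Wh := varControl (fun x : Rd d => ‖x‖ₑ) r₁ (fun s => f s - g s) with hWh
  set Wg := varControl (fun x : Rd d => ‖x‖ₑ) r₁ g with hWg
  -- Chosen so that `A ^ (γ / r₁)` dominates both `Wh ^ (1 / r₁)` and `H * Wg ^ (γ / r₁)`, the two
  -- contributions to the second-order difference. The power `1 / γ ≥ 1` keeps the first summand
  -- superadditive.
  set A : ℝ → ℝ → ℝ≥0∞ := fun s t => Wh s t ^ (1 / γ) + H ^ (γ / r₁)⁻¹ * Wg s t with hA
  set Vh := rVariation (fun x : Rd d => ‖x‖ₑ) r₁ a b (fun s => f s - g s) with hVh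
  set Vg := rVariation (fun x : Rd d => ‖x‖ₑ) r₁ a b g with hVg
  set S : Set ℝ := {τ | τ ∈ Icc a b ∧ ‖f τ - g τ‖ₑ ≤ H} with hSdef
  have hAc : IsControl S A :=
    ((isControl_varControl _ _ _ S).rpow (by rw [le_div_iff₀ hγ]; linarith)).add
      ((isControl_varControl _ _ _ S).const_mul _)
  have hWfin : ∀ k : ℝ → Rd d, rVariation (fun x => ‖x‖ₑ) r₁ a b k < ∞ →
      varControl (fun x : Rd d => ‖x‖ₑ) r₁ k a b ≠ ∞ := fun k hk h => by
    rw [rVariation_eq, h, ENNReal.top_rpow_of_pos (by positivity)] at hk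
    exact lt_irrefl _ hk
  have hsub : ∀ s t, a ≤ s → t ≤ b → AEMeasurable ω (volume.restrict (Ioc s t)) :=
    fun s t hs ht => hω.mono_set (Ioc_subset_Icc_self.trans (Icc_subset_Icc hs ht))
  have hωf : AEMeasurable (fun τ => ω τ + f τ) (volume.restrict (Icc a b)) :=
    hω.add (aemeasurable_of_varControl_ne_top hr₁0 (hWfin f hf))
  have hωg : AEMeasurable (fun τ => ω τ + g τ) (volume.restrict (Icc a b)) :=
    hω.add (aemeasurable_of_varControl_ne_top hr₁0 (hWfin g hg))
  have hS : ∀ᵐ τ ∂volume.restrict (Icc a b), τ ∈ S := by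
    filter_upwards [ae_restrict_mem measurableSet_Icc,
      enorm_ae_le_eLpNormEssSup (fun s => f s - g s) (volume.restrict (Icc a b))] with τ h1 h2
    exact ⟨h1, by rwa [hH, eLpNorm_exponent_top]⟩
  -- The left side is `Vg ^ γ` with `γ ≤ 1`; this is the origin of the factor `1 + Vg` in the
  -- estimate.
  have hVgγ : Wg a b ^ (γ / r₁) ≤ 1 + Vg := by
    have : Wg a b ^ (γ / r₁) = Vg ^ γ := by
      rw [hVg, rVariation_eq, ← ENNReal.rpow_mul, one_div_mul_eq_div]
    rw [this]
    rcases le_total Vg 1 with h | h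
    · exact (ENNReal.rpow_le_one h hγ.le).trans le_self_add
    · exact (ENNReal.rpow_le_rpow_of_exponent_le h hγ₁).trans (by simp)
  have hAab : A a b ^ (γ / r₁) ≤ Vh + (1 + Vg) * H := by
    refine (ENNReal.rpow_add_le_add_rpow _ _ hx.le hx1).trans (add_le_add (le_of_eq ?_) ?_)
    · rw [hVh, rVariation_eq, ← ENNReal.rpow_mul]
      congr 1
      field_simp
    · rw [ENNReal.mul_rpow_of_nonneg _ _ hx.le, ← ENNReal.rpow_mul, inv_mul_cancel₀ hx.ne',
        ENNReal.rpow_one, mul_comm]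
      gcongr
  have key : rVariation (besovNorm (α - γ - 1) p q) r a b
      (fun t => occ (fun s => ω s + f s) a t - occ (fun s => ω s + g s) a t) ≤
      (C * H + K * (2 * C * A a b ^ (γ / r₁))) *
        rVariation (besovNorm α p q) r a b (fun t => occ ω a t) := by
    refine rVariation_le_of_increment_le hr fun s t has hst htb => ?_
    rw [sub_sub_sub_comm, occ_sub_occ has hst htb hωf, occ_sub_occ has hst htb hωg]
    rcases hst.eq_or_lt with rfl | hst'
    · rw [occ_self, occ_self, sub_zero, besovNorm_zero hq]
      exact zero_le
    obtain ⟨π, hmono, hmem, hπ⟩ := exists_partitions has hst' htb hS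
    have hlim : ∀ k : ℝ → Rd d, rVariation (fun x => ‖x‖ₑ) r₁ a b k < ∞ → _ := fun k hk =>
      tendsto_riemann_blockField hr₁0 has htb hω (hWfin k hk) hmono (fun n i => (hmem n i).2) hπ
    refine besovNorm_le_of_tendsto hq
      (U := fun n => ∑ i ∈ Finset.range n, (occ (fun τ => ω τ + f (π n i)) (π n i) (π n (i + 1)) -
        occ (fun τ => ω τ + g (π n i)) (π n i) (π n (i + 1))))
      (fun n j => HasField.sum fun i _ =>
        (hasField_occ j (fun τ => ω τ + f (π n i)) (π n i) (π n (i + 1))).sub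
          (hasField_occ j (fun τ => ω τ + g (π n i)) (π n i) (π n (i + 1))))
      (fun j => (hasField_occ j _ s t).sub (hasField_occ j _ s t))
      (fun j x => by
        simp_rw [Finset.sum_sub_distrib]
        exact (hlim f hf j x).sub (hlim g hg j x)) fun n => ?_
    refine (hK (besovNorm_zero hq) (besovNorm_add_le (α := α - γ - 1) hq) (S := S) hAc
      (isControl_varControl (besovNorm α p q) r (fun t => occ ω a t) _)
      (Ξ := fun u v => occ (fun τ => ω τ + f u) u v - occ (fun τ => ω τ + g u) u v)
      (c := C * H) (C := 2 * C) (fun u _ => by simp [occ_self]) (fun u hu v hv huv => ?_)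
      (fun u hu m hm v hv hum hmv => ?_) n (π n) (hmono n) (fun i => (hmem n i).1)).trans ?_
    -- The germ is bounded with the full derivative of order one, so it is linear in `|f u - g u|`.
    -- That is at most `H` because `u` lies in `S`.
    · have h1 := (hC 1 (α - γ) u v ω zero_le_one le_rfl (hsub u v hu.1.1 hv.1.2)).1 (f u) (g u)
      rw [ENNReal.rpow_one] at h1
      refine h1.trans ?_
      gcongr
      · exact hu.2
      · exact (besovNorm_occ_mono (by linarith) ω u v).trans
          (besovNorm_occ_le hr hu.1.1 huv hv.1.2 hω)
    · have hωuv := hsub u v hu.1.1 hv.1.2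
      have heq : (occ (fun τ => ω τ + f u) u m - occ (fun τ => ω τ + g u) u m) +
          (occ (fun τ => ω τ + f m) m v - occ (fun τ => ω τ + g m) m v) -
          (occ (fun τ => ω τ + f u) u v - occ (fun τ => ω τ + g u) u v) =
          (occ (fun τ => ω τ + f m) m v - occ (fun τ => ω τ + g m) m v) -
          (occ (fun τ => ω τ + f u) m v - occ (fun τ => ω τ + g u) m v) := by
        rw [← occ_add_occ hum hmv (hωuv.add_const (f u)),
          ← occ_add_occ hum hmv (hωuv.add_const (g u))]
        abel
      rw [heq]
      refine ((hC γ α m v ω hγ.le hγ₁ (hsub m v hm.1.1 hv.1.2)).2 (f u) (g u) (f m) (g m)).trans ?_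
      have h1 : ‖(f m - g m) - (f u - g u)‖ₑ ≤ A u m ^ (γ / r₁) := by
        refine (le_varControl_rpow (fun x : Rd d => ‖x‖ₑ) hr₁0 (fun s => f s - g s) hum).trans ?_
        calc Wh u m ^ (1 / r₁) = (Wh u m ^ (1 / γ)) ^ (γ / r₁) := by
              rw [← ENNReal.rpow_mul]; congr 1; field_simp
          _ ≤ _ := ENNReal.rpow_le_rpow le_self_add hx.le
      have h2 : ‖g m - g u‖ₑ ^ γ * ‖f u - g u‖ₑ ≤ A u m ^ (γ / r₁) := by
        calc ‖g m - g u‖ₑ ^ γ * ‖f u - g u‖ₑ ≤ (Wg u m ^ (1 / r₁)) ^ γ * H :=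
              mul_le_mul' (ENNReal.rpow_le_rpow
                (le_varControl_rpow (fun x : Rd d => ‖x‖ₑ) hr₁0 g hum) hγ.le) hu.2
          _ = (H ^ (γ / r₁)⁻¹ * Wg u m) ^ (γ / r₁) := by
              rw [ENNReal.mul_rpow_of_nonneg _ _ hx.le, ← ENNReal.rpow_mul, ← ENNReal.rpow_mul,
                inv_mul_cancel₀ hx.ne', ENNReal.rpow_one, one_div_mul_eq_div, mul_comm]
          _ ≤ _ := ENNReal.rpow_le_rpow le_add_self hx.le
      calc _ ≤ (C : ℝ≥0∞) * (A u m ^ (γ / r₁) + A u m ^ (γ / r₁)) *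
            varControl (besovNorm α p q) r (fun t => occ ω a t) m v ^ (1 / r) := by
              gcongr
              exact besovNorm_occ_le hr hm.1.1 hmv hv.1.2 hω
        _ = _ := by ring
    · have hπa := has.trans (hmem n 0).2.1.le
      have hπb := (hmem n n).2.2.le.trans htb
      have hAm : A (π n 0) (π n n) ≤ A a b :=
        add_le_add (ENNReal.rpow_le_rpow (varControl_mono _ _ _ hπa hπb) (by positivity))
          (mul_le_mul_right (varControl_mono _ _ _ hπa hπb) _)
      gcongr
      exact varControl_mono _ _ _ (hmem n 0).2.1.le (hmem n n).2.2.le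
  refine key.trans ?_
  have hHle : H ≤ Vh + (1 + Vg) * H := by
    rw [add_mul, one_mul]
    exact le_self_add.trans le_add_self
  calc _ ≤ (C * (Vh + (1 + Vg) * H) + K * (2 * C * (Vh + (1 + Vg) * H))) *
        rVariation (besovNorm α p q) r a b (fun t => occ ω a t) := by gcongr
    _ = _ := by push_cast; ring

end

end OccBesov

theorem proposition3p3 (d : ℕ) (α : ℝ) (p q : ℝ≥0∞) [Fact (1 ≤ p)] (hp : 1 < p) (hp' : p < ∞)
    (hq : 1 ≤ q) (r r' r₁ γ : ℝ) (hr : 1 < r) (hrr' : r.HolderConjugate r') (hr₁ : 1 ≤ r₁)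
    (hγ : r₁ / r' < γ) (hγ₁ : γ ≤ 1) :
    (∀ (a b : ℝ) (ω f : ℝ → OccBesov.Rd d), a ≤ b →
      AEMeasurable ω (volume.restrict (Icc a b)) →
      OccBesov.MemV (OccBesov.besovNorm α p q) r a b (fun t => OccBesov.occ ω a t) →
      OccBesov.MemV (fun x => ‖x‖ₑ) r₁ a b f →
      OccBesov.MemV (OccBesov.besovNorm (α - γ) p q) r a b
        (fun t => OccBesov.occ (fun s => ω s + f s) a t)) ∧
    ∃ C : ℝ≥0, ∀ (a b : ℝ) (ω f g : ℝ → OccBesov.Rd d), a ≤ b →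
      AEMeasurable ω (volume.restrict (Icc a b)) →
      OccBesov.MemV (OccBesov.besovNorm α p q) r a b (fun t => OccBesov.occ ω a t) →
      OccBesov.MemV (fun x => ‖x‖ₑ) r₁ a b f →
      OccBesov.MemV (fun x => ‖x‖ₑ) r₁ a b g →
      OccBesov.rVariation (OccBesov.besovNorm (α - γ - 1) p q) r a b
          (fun t => OccBesov.occ (fun s => ω s + f s) a t
            - OccBesov.occ (fun s => ω s + g s) a t)
        ≤ C * OccBesov.rVariation (OccBesov.besovNorm α p q) r a b
              (fun t => OccBesov.occ ω a t)
          * (OccBesov.rVariation (fun x => ‖x‖ₑ) r₁ a b (fun s => f s - g s)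
            + (1 + OccBesov.rVariation (fun x => ‖x‖ₑ) r₁ a b g)
              * eLpNorm (fun s => f s - g s) ∞ (volume.restrict (Icc a b))) := by
  have hr0 : 0 < r := by linarith
  have hr₁0 : 0 < r₁ := by linarith
  have hγ0 : 0 < γ := (div_pos hr₁0 hrr'.symm.pos).trans hγ
  -- As `1 / r' = 1 - 1 / r`, the lower bound on `γ` is the Young condition.
  have hyoung : 1 < γ / r₁ + 1 / r := by
    have h1 : 1 / r' < γ / r₁ := by
      rw [lt_div_iff₀ hr₁0, one_div_mul_eq_div]
      exact hγ
    have h2 := hrr'.inv_add_inv_eq_one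
    rw [one_div] at h1 ⊢
    linarith
  refine ⟨fun a b ω f _ hω hμ hf => ?_, ?_⟩
  · obtain ⟨C, hC⟩ := OccBesov.exists_rVariation_occ_add_le d (q := q) hp hp' hq hr0 hr₁0 hγ0 hγ₁
      hyoung
    have hfin : OccBesov.rVariation (OccBesov.besovNorm (α - γ) p q) r a b
        (fun t => OccBesov.occ (fun s => ω s + f s) a t) < ∞ := by
      refine (hC α a b ω f hω hf.2).trans_lt (ENNReal.mul_lt_top ?_ hμ.2)
      exact ENNReal.add_lt_top.2 ⟨ENNReal.one_lt_top, ENNReal.mul_lt_top ENNReal.coe_lt_top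
        (ENNReal.rpow_lt_top_of_nonneg hγ0.le hf.2.ne)⟩
    -- The path starts at `0`, so its value at `t` is an increment and is bounded by the variation.
    refine ⟨fun t ht => lt_of_le_of_lt ?_ hfin, hfin⟩
    have := OccBesov.le_varControl_rpow (OccBesov.besovNorm (α - γ) p q) hr0
      (fun t => OccBesov.occ (fun s => ω s + f s) a t) ht.1
    simp only [OccBesov.occ_self, sub_zero] at this
    exact this.trans (ENNReal.rpow_le_rpow (OccBesov.varControl_mono _ _ _ le_rfl ht.2)
      (by positivity))
  · obtain ⟨C, hC⟩ := OccBesov.exists_rVariation_occ_sub_le d (q := q) hp hp' hq hr0 hr₁ hγ0 hγ₁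
      hyoung
    exact ⟨C, fun a b ω f g _ hω _ hf hg => hC α a b ω f g hω hf.2 hg.2⟩
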